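/- For $n\ge 1$ let $R_n(x)=\operatorname{sign}(\sin 2^n\pi x)$, $x\in[0,1]$, be the Rademacher functions, and let $\{W_n\}_{n\ge 0}$ be the Walsh system: $W_0\equiv 1$ and $W_n=\prod_{i=1}^p R_{k_i+1}$ when $n=2^{k_1}+\dots+2^{k_p}$ with $k_1>\dots>k_p\ge 0$. All functions are real-valued. For $g\in L^1[0,1]$ put $c_k(g)=\int_0^1 g(x)W_k(x)\,dx$. A weight is a measurable function $\mu$ on $[0,1]$ with $0<\mu(x)\le 1$ for all $x\in[0,1]$, and $L^1_\mu[0,1]$ is the class of measurable functions $f$ on $[0,1]$ with $\int_0^1|f(x)|\mu(x)\,dx<\infty$. **Theorem.** For every $\delta>0$ there exist a function $g\in L^1[0,1]$ and a weight $\mu$ on $[0,1]$ such that: 1. $g$ is universal for $L^1_\mu[0,1]$ with respect to signs of its Fourier–Walsh coefficients, i.e. for every $f\in L^1_\mu[0,1]$ there are signs $\delta_k=\pm1$ $(k\ge 0)$ with $$\lim_{m\to\infty}\int_0^1\Big|\sum_{k=0}^m\delta_k c_k(g)W_k(x)-f(x)\Big|\,\mu(x)\,dx=0;$$ 2. $\big|\{x\in[0,1]:\mu(x)=1\}\big|>1-\delta$,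 where $|\cdot|$ is Lebesgue measure; 3. the sequence $(c_k(g))_{k\ge 0}$ is strictly decreasing and converges to $0$; 4. the Fourier–Walsh series of $g$ converges to $g$ in $L^1[0,1]$: $$\lim_{m\to\infty}\int_0^1\Big|\sum_{k=0}^m c_k(g)W_k(x)-g(x)\Big|\,dx=0.$$ -/

import Mathlib

open MeasureTheory Set Filter Topology

noncomputable section

/-- The Rademacher function `R_n(x) = sign (sin (2 ^ n π x))` (used for `n ≥ 1`). -/
def rademacher (n : ℕ) (x : ℝ) : ℝ :=
  Real.sign (Real.sin (2 ^ n * Real.pi * x))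

/-- The Walsh function `W_n` in Paley's numbering: if `n = 2 ^ k₁ + ⋯ + 2 ^ k_p` with distinct
`k_i`, then `W_n = ∏ R_{k_i + 1}`; in particular `W_0 = 1`. The list `n.bitIndices` consists of the
exponents `k_i`. -/
def walsh (n : ℕ) (x : ℝ) : ℝ :=
  (n.bitIndices.map fun k => rademacher (k + 1) x).prod

/-- The Fourier–Walsh coefficient `c_k(g) = ∫₀¹ g W_k`. -/
def walshCoeff (g : ℝ → ℝ) (k : ℕ) : ℝ :=
  ∫ x in Icc (0 : ℝ) 1, g x * walsh k x

/-- A weight function on `[0,1]`: measurable, with `0 < μ ≤ 1` on `[0,1]`. The values outside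
`[0,1]` play no role. -/
structure IsWeight (μ : ℝ → ℝ) : Prop where
  measurable : Measurable μ
  pos : ∀ x ∈ Icc (0 : ℝ) 1, 0 < μ x
  le_one : ∀ x ∈ Icc (0 : ℝ) 1, μ x ≤ 1

/-- Membership in the weighted space `L¹_μ[0,1]`: `f` is measurable on `[0,1]` and
`∫₀¹ |f| μ < ∞`. -/
def MemWeightedL1 (μ f : ℝ → ℝ) : Prop :=
  AEMeasurable f (volume.restrict (Icc (0 : ℝ) 1)) ∧
    IntegrableOn (fun x => |f x| * μ x) (Icc (0 : ℝ) 1)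

/-- `g ∈ L¹[0,1]` is universal for `L¹_μ[0,1]` with respect to signs of its Fourier–Walsh
coefficients: for every `f ∈ L¹_μ[0,1]` there are signs `δ_k = ±1` such that the partial sums of
`∑ δ_k c_k(g) W_k` converge to `f` in the metric of `L¹_μ[0,1]`. -/
def IsUniversalForSigns (μ g : ℝ → ℝ) : Prop :=
  IntegrableOn g (Icc (0 : ℝ) 1) ∧
    ∀ f : ℝ → ℝ, MemWeightedL1 μ f →
      ∃ δ : ℕ → ℝ, (∀ k, δ k = 1 ∨ δ k = -1) ∧
        Tendsto
          (fun m : ℕ => ∫ x in Icc (0 : ℝ) 1,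
            |(∑ k ∈ Finset.range (m + 1), δ k * walshCoeff g k * walsh k x) - f x| * μ x)
          atTop (𝓝 0)

end

/-! Write `r_t` for the Rademacher functions indexed from 0 and `w_k` for the Walsh functions.
Frequencies are grouped into steps `[2^s, 2^(s+l))`. If the signs in a step depend only on `k mod
2^s`, the signed sum factors as `(P - 1) * Q`, where `P = ∏ (1 + r_t)` over `s ≤ t < s + l` and `Q`
is a Walsh polynomial with frequencies below `2^s` (`sum_Ico_periodic_mul_wal`). Almost everywhere
off a set of measure `2^-l` one has `P = 0`, so the step yields `-Q`. Signs `-τ w_j(b)` for `j <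
2^K` and `+1` beyond make `-Q` equal to `τ 2^K` on the dyadic cell `b` and 0 on the other cells, off
one cell of measure `2^-K` carrying the kernels of order `2^K` and `2^s`. Thus a step adds or
subtracts a multiple of any prescribed cell indicator, or contributes nothing, off an exceptional
set independent of that choice (`exists_step_signs`). The weight can therefore be fixed before the
target function is known: it is made small enough on each exceptional set that the error there
becomes summable, and it stays 1 off their union.

Steps are grouped into phases. In phase `n` the cells have rank `K = κ + n`, and the coefficients `C
i` are small but have sum at least `n`; a greedy choice of cells and signs then builds any cell
function `v` with `∑ |v b| ≤ n 2^K`, with partial sums dominated by `|v|` up to `O(2^-n)` in mean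
(`exists_greedy_masses`, `exists_phase`). Cell functions of bounded height are eventually allowed
and are dense, so successive corrections converge to any target (`exists_corrections_tendsto_zero`).

Partial sums inside a step are controlled by the logarithmic growth of Dirichlet kernels, which
requires `C i * s (i+1)` to be small. With `l i ~ 2 log i` one has `s i = O(i log i)`, so `∑ 2^-l`
converges while `∑ 1/s` diverges (`exists_walshScheme`). With all signs `+1`, Abel summation and the
bound 1 for the kernels of order `2^s` give convergence in `L¹` to `g`; the extra term `2^-k` in the
coefficients makes them strictly decreasing. -/

/-! ### Algebra of Walsh products -/

/-- The product of `r i` over the binary digits `i` of `n`. -/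
noncomputable def wal (r : ℕ → ℝ) (n : ℕ) : ℝ := (n.bitIndices.map r).prod

@[simp] theorem wal_zero (r : ℕ → ℝ) : wal r 0 = 1 := by simp [wal]

theorem bitIndices_two_pow_add {s j : ℕ} (hj : j < 2 ^ s) :
    (2 ^ s + j).bitIndices = j.bitIndices ++ [s] := by
  have hmem : ∀ a ∈ j.bitIndices, a < s := fun a ha =>
    (Nat.pow_lt_pow_iff_right (by norm_num : 1 < 2)).1
      ((Nat.two_pow_le_of_mem_bitIndices ha).trans_lt hj)
  have hs : (j.bitIndices ++ [s]).SortedLT := by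
    exact (List.pairwise_append.2 ⟨Nat.bitIndices_sorted.pairwise, by simp,
      by simpa using hmem⟩).sortedLT
  have := Nat.bitIndices_sum_map_two_pow hs
  rw [← this]
  congr 1
  simp [add_comm]

theorem wal_two_pow_add (r : ℕ → ℝ) {s j : ℕ} (hj : j < 2 ^ s) :
    wal r (2 ^ s + j) = r s * wal r j := by
  simp [wal, bitIndices_two_pow_add hj, mul_comm]

theorem two_pow_mul_add_lt {s l q j : ℕ} (hq : q < 2 ^ l) (hj : j < 2 ^ s) :
    2 ^ s * q + j < 2 ^ (s + l) := by
  calc 2 ^ s * q + j < 2 ^ s * q + 2 ^ s := by omega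
    _ = 2 ^ s * (q + 1) := by ring
    _ ≤ 2 ^ s * 2 ^ l := Nat.mul_le_mul_left _ hq
    _ = 2 ^ (s + l) := (pow_add _ _ _).symm

theorem wal_shift_two_pow_add (r : ℕ → ℝ) {s l q j : ℕ} (hq : q < 2 ^ l) (hj : j < 2 ^ s) :
    wal r (2 ^ s * (2 ^ l + q) + j) = r (s + l) * wal r (2 ^ s * q + j) := by
  rw [← wal_two_pow_add r (two_pow_mul_add_lt hq hj)]
  congr 1
  ring

/-- The binary digits of `2^s * q` and of `j` are disjoint. -/
theorem wal_shift_add (r : ℕ → ℝ) {s : ℕ} (q : ℕ) {j : ℕ} (hj : j < 2 ^ s) :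
    wal r (2 ^ s * q + j) = wal r (2 ^ s * q) * wal r j := by
  have key : ∀ l q, q < 2 ^ l → wal r (2 ^ s * q + j) = wal r (2 ^ s * q) * wal r j := by
    intro l
    induction l with
    | zero => intro q hq; obtain rfl : q = 0 := by simpa using hq
              simp
    | succ l ih =>
      intro q hq
      by_cases h : q < 2 ^ l
      · exact ih q h
      · obtain ⟨q', rfl⟩ := Nat.exists_eq_add_of_le (not_lt.1 h)
        have hq' : q' < 2 ^ l := by rw [pow_succ] at hq; omega
        have h0 := wal_shift_two_pow_add r hq' (j := 0) (s := s) (by positivity)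
        rw [add_zero, add_zero] at h0
        rw [wal_shift_two_pow_add r hq' hj, h0, ih q' hq', mul_assoc]
  exact key q q Nat.lt_two_pow_self

theorem wal_shift_top (r : ℕ → ℝ) (s : ℕ) {l q : ℕ} (hq : q < 2 ^ l) :
    wal r (2 ^ s * (2 ^ l + q)) = r (s + l) * wal r (2 ^ s * q) := by
  simpa using wal_shift_two_pow_add r hq (j := 0) (s := s) (by positivity)

/-- Expanding the product, each subset of the factors is the digit set of exactly one `q`. For `s =
0` this is Paley's formula for the Dirichlet kernel of order `2^l`. -/
theorem sum_range_wal_shift (r : ℕ → ℝ) (s l : ℕ) :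
    ∑ q ∈ Finset.range (2 ^ l), wal r (2 ^ s * q) = ∏ t ∈ Finset.range l, (1 + r (s + t)) := by
  induction l with
  | zero => simp
  | succ l ih =>
    have : 2 ^ (l + 1) = 2 ^ l + 2 ^ l := by ring
    rw [this, Finset.sum_range_add, Finset.prod_range_succ, ← ih,
      Finset.sum_congr rfl (fun q hq => wal_shift_top r s (Finset.mem_range.1 hq)),
      ← Finset.mul_sum]
    ring

theorem sum_range_wal (r : ℕ → ℝ) (l : ℕ) :
    ∑ q ∈ Finset.range (2 ^ l), wal r q = ∏ t ∈ Finset.range l, (1 + r t) := by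
  simpa using sum_range_wal_shift r 0 l

/-- With `b` the signs of a dyadic cell, a Dirichlet sum twisted by `wal b` again becomes a product,
concentrated on that cell. -/
theorem wal_mul (r b : ℕ → ℝ) (n : ℕ) : wal (fun t => r t * b t) n = wal r n * wal b n := by
  simp [wal, List.prod_map_mul]

theorem abs_wal_le_one {r : ℕ → ℝ} (hr : ∀ t, |r t| ≤ 1) (n : ℕ) : |wal r n| ≤ 1 := by
  unfold wal
  induction n.bitIndices with
  | nil => simp
  | cons a L ih =>
    rw [List.map_cons, List.prod_cons, abs_mul]
    exact mul_le_one₀ (hr a) (abs_nonneg _) ih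

theorem wal_eq_one_or {r : ℕ → ℝ} (hr : ∀ t, r t = 1 ∨ r t = -1) (n : ℕ) :
    wal r n = 1 ∨ wal r n = -1 := by
  unfold wal
  induction n.bitIndices with
  | nil => simp
  | cons a L ih =>
    rw [List.map_cons, List.prod_cons]
    rcases hr a with h | h <;> rcases ih with h' | h' <;> simp [h, h']

theorem wal_eq_prod (r : ℕ → ℝ) (n : ℕ) : wal r n = ∏ i ∈ n.bitIndices.toFinset, r i := by
  rw [List.prod_toFinset _ Nat.bitIndices_nodup, wal]

/-- Splitting a range sum at a multiple of `2 ^ s`. -/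
theorem sum_range_two_pow_mul_add (f : ℕ → ℝ) (s q j : ℕ) :
    ∑ k ∈ Finset.range (2 ^ s * q + j), f k =
      ∑ p ∈ Finset.range q, ∑ i ∈ Finset.range (2 ^ s), f (2 ^ s * p + i) +
        ∑ i ∈ Finset.range j, f (2 ^ s * q + i) := by
  rw [Finset.sum_range_add]
  congr 1
  induction q with
  | zero => simp
  | succ q ih => rw [Finset.sum_range_succ, ← ih, mul_add, mul_one, Finset.sum_range_add]

/-! ### Rademacher and Walsh functions on the unit interval -/

/-- Lebesgue measure on the unit interval. -/
noncomputable abbrev unitMeasure : Measure ℝ := volume.restrict (Icc (0 : ℝ) 1)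

instance isProbabilityMeasure_unitMeasure : IsProbabilityMeasure unitMeasure :=
  ⟨by simp [unitMeasure]⟩

/-- The Rademacher sequence at a point, indexed from `0`. -/
noncomputable def radSeq (x : ℝ) (k : ℕ) : ℝ := rademacher (k + 1) x

theorem walsh_eq (n : ℕ) (x : ℝ) : walsh n x = wal (radSeq x) n := rfl

theorem measurable_realSign : Measurable Real.sign := by
  unfold Real.sign
  exact Measurable.ite measurableSet_Iio measurable_const
    (Measurable.ite measurableSet_Ioi measurable_const measurable_const)

theorem abs_realSign_le_one (x : ℝ) : |Real.sign x| ≤ 1 := by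
  rcases Real.sign_apply_eq x with h | h | h <;> simp [h]

theorem measurable_radSeq (k : ℕ) : Measurable fun x => radSeq x k := by
  unfold radSeq rademacher
  exact measurable_realSign.comp (by fun_prop)

theorem abs_radSeq_le_one (x : ℝ) (k : ℕ) : |radSeq x k| ≤ 1 := abs_realSign_le_one _

theorem radSeq_add_half_pow_self (x : ℝ) (i : ℕ) :
    radSeq (x + (1 / 2) ^ (i + 1)) i = -radSeq x i := by
  unfold radSeq rademacher
  have : (2 : ℝ) ^ (i + 1) * Real.pi * (x + (1 / 2) ^ (i + 1)) =
      2 ^ (i + 1) * Real.pi * x + Real.pi := by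
    rw [mul_add, mul_right_comm ((2 : ℝ) ^ (i + 1)) Real.pi ((1 / 2) ^ (i + 1)), ← mul_pow]
    norm_num
  rw [this, Real.sin_add_pi, Real.sign_neg]

theorem radSeq_add_half_pow_of_lt (x : ℝ) {i j : ℕ} (h : i ≤ j) :
    radSeq (x + (1 / 2) ^ i) j = radSeq x j := by
  unfold radSeq rademacher
  obtain ⟨d, rfl⟩ := Nat.exists_eq_add_of_le h
  have : (2 : ℝ) ^ (i + d + 1) * Real.pi * (x + (1 / 2) ^ i) =
      2 ^ (i + d + 1) * Real.pi * x + ((2 ^ d : ℕ) : ℝ) * (2 * Real.pi) := by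
    have h1 : (2 : ℝ) ^ i * (1 / 2) ^ i = 1 := by rw [← mul_pow]; norm_num
    push_cast
    rw [pow_succ, pow_add]
    linear_combination (2 * 2 ^ d * Real.pi) * h1
  rw [this, Real.sin_add_nat_mul_two_pi]

theorem radSeq_add_one (x : ℝ) (j : ℕ) : radSeq (x + 1) j = radSeq x j := by
  simpa using radSeq_add_half_pow_of_lt x (Nat.zero_le j)

theorem ae_radSeq_eq_one_or (m : Measure ℝ) [NullSingletonClass m] :
    ∀ᵐ x ∂m, ∀ k, radSeq x k = 1 ∨ radSeq x k = -1 := by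
  have hc : (⋃ k : ℕ, ⋃ z : ℤ, {(z : ℝ) / 2 ^ (k + 1)}).Countable :=
    countable_iUnion fun k => countable_iUnion fun z => countable_singleton _
  filter_upwards [hc.ae_notMem m] with x hx k
  simp only [mem_iUnion, mem_singleton_iff, not_exists] at hx
  have hne : Real.sin (2 ^ (k + 1) * Real.pi * x) ≠ 0 := by
    intro h0
    obtain ⟨z, hz⟩ := Real.sin_eq_zero_iff.1 h0
    apply hx k z
    have : (z : ℝ) = 2 ^ (k + 1) * x := by
      apply mul_right_cancel₀ Real.pi_ne_zero
      rw [hz]; ring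
    rw [this]; field_simp
  rcases lt_or_gt_of_ne hne with h | h
  · right; exact Real.sign_of_neg h
  · left; exact Real.sign_of_pos h

theorem measurable_wal (n : ℕ) : Measurable fun x => wal (radSeq x) n := by
  simp only [wal_eq_prod]
  exact Finset.measurable_prod _ fun i _ => measurable_radSeq i

theorem abs_walsh_le_one (n : ℕ) (x : ℝ) : |walsh n x| ≤ 1 :=
  abs_wal_le_one (abs_radSeq_le_one x) n

theorem measurable_walsh (n : ℕ) : Measurable (walsh n) := measurable_wal n

theorem Measurable.integrable_of_abs_le {α : Type*} [MeasurableSpace α] {m : Measure α}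
    [IsFiniteMeasure m] {f : α → ℝ} (hf : Measurable f) {B : ℝ} (hB : ∀ x, |f x| ≤ B) :
    Integrable f m :=
  Integrable.of_bound hf.aestronglyMeasurable B (Eventually.of_forall hB)

theorem integrable_walsh (m : Measure ℝ) [IsFiniteMeasure m] (n : ℕ) : Integrable (walsh n) m :=
  (measurable_walsh n).integrable_of_abs_le (abs_walsh_le_one n)

/-- A linear combination of Walsh functions is integrable. -/
theorem integrable_sum_walsh (m : Measure ℝ) [IsFiniteMeasure m] (F : Finset ℕ) (a : ℕ → ℝ) :
    Integrable (fun x => ∑ k ∈ F, a k * walsh k x) m :=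
  integrable_finsetSum _ fun k _ => (integrable_walsh m k).const_mul _

theorem integral_prod_radSeq {F : Finset ℕ} (hF : F.Nonempty) :
    ∫ x, ∏ i ∈ F, radSeq x i ∂unitMeasure = 0 := by
  set f : ℝ → ℝ := fun x => ∏ i ∈ F, radSeq x i with hf
  have hper : Function.Periodic f 1 := fun x => by simp [hf, radSeq_add_one]
  -- Translation by `2^-(i₀+1)` flips the factor of least index and is a period of all the others,
  -- so the integral equals its own negative.
  set i₀ := F.min' hF
  have hflip : ∀ x, f (x + (1 / 2) ^ (i₀ + 1)) = -f x := by
    intro x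
    simp only [hf]
    rw [← Finset.mul_prod_erase F _ (F.min'_mem hF), ← Finset.mul_prod_erase F _ (F.min'_mem hF),
      radSeq_add_half_pow_self, neg_mul]
    congr 2
    refine Finset.prod_congr rfl fun j hj => radSeq_add_half_pow_of_lt x ?_
    exact Nat.succ_le_of_lt (lt_of_le_of_ne (F.min'_le j (Finset.mem_of_mem_erase hj))
      (Finset.ne_of_mem_erase hj).symm)
  have h1 : ∫ x in (0 : ℝ)..1, f x = -∫ x in (0 : ℝ)..1, f x := by
    have h2 := hper.intervalIntegral_add_eq 0 ((1 / 2) ^ (i₀ + 1))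
    rw [zero_add] at h2
    have h3 := intervalIntegral.integral_comp_add_right (a := 0) (b := 1) f ((1 / 2) ^ (i₀ + 1))
    simp only [hflip, intervalIntegral.integral_neg, zero_add] at h3
    rw [h3, h2, add_comm 1]
  rw [integral_Icc_eq_integral_Ioc, ← intervalIntegral.integral_of_le zero_le_one]
  linarith

theorem integral_walsh_mul_walsh (j k : ℕ) :
    ∫ x, walsh j x * walsh k x ∂unitMeasure = if j = k then 1 else 0 := by
  set J := j.bitIndices.toFinset
  set K := k.bitIndices.toFinset
  have hae : ∀ᵐ x ∂unitMeasure, walsh j x * walsh k x = ∏ i ∈ symmDiff J K, radSeq x i := by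
    filter_upwards [ae_radSeq_eq_one_or unitMeasure] with x hx
    have hsq : ∀ i, radSeq x i * radSeq x i = 1 := fun i => by
      rcases hx i with h | h <;> simp [h]
    rw [walsh_eq, walsh_eq, wal_eq_prod, wal_eq_prod]
    change (∏ i ∈ J, radSeq x i) * (∏ i ∈ K, radSeq x i) = _
    rw [← Finset.prod_sdiff (Finset.inter_subset_left : J ∩ K ⊆ J),
      ← Finset.prod_sdiff (Finset.inter_subset_right : J ∩ K ⊆ K), mul_mul_mul_comm,
      ← Finset.prod_mul_distrib (s := J ∩ K), Finset.prod_congr rfl (fun i _ => hsq i),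
      Finset.prod_const_one, mul_one, Finset.sdiff_inter_self_left, Finset.sdiff_inter_self_right,
      symmDiff_def, Finset.sup_eq_union, Finset.prod_union]
    exact disjoint_sdiff_sdiff
  rw [integral_congr_ae hae]
  by_cases h : j = k
  · subst h; simp [J, K]
  · rw [if_neg h]
    apply integral_prod_radSeq
    rw [Finset.nonempty_iff_ne_empty]
    intro h0
    apply h
    have hJK : J = K := symmDiff_eq_bot.1 h0
    rw [← Finset.sum_toFinset_bitIndices_two_pow j, ← Finset.sum_toFinset_bitIndices_two_pow k]
    change ∑ i ∈ J, 2 ^ i = ∑ i ∈ K, 2 ^ i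
    rw [hJK]

theorem integral_walsh (k : ℕ) : ∫ x, walsh k x ∂unitMeasure = if k = 0 then 1 else 0 := by
  have := integral_walsh_mul_walsh k 0
  simpa [walsh_eq] using this

theorem prod_one_add_radSeq_nonneg (x : ℝ) (F : Finset ℕ) (e : ℕ → ℕ) :
    0 ≤ ∏ t ∈ F, (1 + radSeq x (e t)) :=
  Finset.prod_nonneg fun t _ => by linarith [abs_le.1 (abs_radSeq_le_one x (e t))]

theorem integral_prod_one_add_radSeq (s l : ℕ) :
    ∫ x, ∏ t ∈ Finset.range l, (1 + radSeq x (s + t)) ∂unitMeasure = 1 := by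
  simp only [← sum_range_wal_shift, ← walsh_eq]
  rw [integral_finsetSum _ fun k _ => integrable_walsh _ _]
  simp only [integral_walsh]
  simp

theorem integrable_prod_one_add_radSeq (m : Measure ℝ) [IsFiniteMeasure m] (s l : ℕ) :
    Integrable (fun x => ∏ t ∈ Finset.range l, (1 + radSeq x (s + t))) m := by
  simp only [← sum_range_wal_shift, ← walsh_eq]
  exact integrable_finsetSum _ fun k _ => integrable_walsh _ _

/-- Logarithmic bound for the `L¹` norm of dilated Walsh–Dirichlet kernels. -/
theorem integral_abs_sum_walsh_shift_le (s : ℕ) {l m : ℕ} (hm : m ≤ 2 ^ l) :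
    ∫ x, |∑ q ∈ Finset.range m, walsh (2 ^ s * q) x| ∂unitMeasure ≤ l + 1 := by
  have hint : ∀ n, Integrable (fun x => ∑ q ∈ Finset.range n, walsh (2 ^ s * q) x) unitMeasure :=
    fun n => integrable_finsetSum _ fun k _ => integrable_walsh _ _
  induction l generalizing m with
  | zero =>
    calc _ ≤ ∫ x, (1 : ℝ) ∂unitMeasure := by
          refine integral_mono (hint m).abs (integrable_const _) fun x => ?_
          obtain rfl | rfl : m = 0 ∨ m = 1 := by rw [pow_zero] at hm; omega
          · simp
          · simpa using abs_walsh_le_one _ x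
      _ = _ := by simp
  | succ l ih =>
    by_cases h : m ≤ 2 ^ l
    · exact (ih h).trans (by push_cast; linarith)
    · obtain ⟨n, rfl⟩ := Nat.exists_eq_add_of_le (not_le.1 h).le
      have hn : n ≤ 2 ^ l := by rw [pow_succ] at hm; omega
      -- For `m = 2^l + n` the sum is a nonnegative product of integral 1 plus `r_{s+l}` times the
      -- sum of length `n`, so each binary digit costs at most 1.
      have hP := integral_prod_one_add_radSeq s l
      calc _ ≤ ∫ x, (∏ t ∈ Finset.range l, (1 + radSeq x (s + t)) +
                |∑ q ∈ Finset.range n, walsh (2 ^ s * q) x|) ∂unitMeasure := by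
            refine integral_mono (hint _).abs
              ((integrable_prod_one_add_radSeq _ s l).add (hint n).abs) fun x => ?_
            simp only [Finset.sum_range_add, walsh_eq]
            rw [sum_range_wal_shift, Finset.sum_congr rfl (fun q hq =>
              wal_shift_top (radSeq x) s ((Finset.mem_range.1 hq).trans_le hn)), ← Finset.mul_sum]
            refine (abs_add_le _ _).trans (add_le_add (abs_of_nonneg ?_).le ?_)
            · exact prod_one_add_radSeq_nonneg x _ _
            · rw [abs_mul]
              exact mul_le_of_le_one_left (abs_nonneg _) (abs_radSeq_le_one _ _)
        _ = 1 + ∫ x, |∑ q ∈ Finset.range n, walsh (2 ^ s * q) x| ∂unitMeasure := by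
            rw [integral_add (integrable_prod_one_add_radSeq _ s l) (hint n).abs, hP]
        _ ≤ _ := by push_cast; linarith [ih hn]

/-- The set where the Rademacher functions with indices in `[s, s + l)` all equal `1`. -/
def radOnes (s l : ℕ) : Set ℝ := {x | ∀ t < l, radSeq x (s + t) = 1}

theorem measurableSet_radOnes (s l : ℕ) : MeasurableSet (radOnes s l) := by
  have : radOnes s l = ⋂ t, ⋂ (_ : t < l), (fun x => radSeq x (s + t)) ⁻¹' {1} := by
    ext x; simp [radOnes]
  rw [this]
  exact MeasurableSet.iInter fun t => MeasurableSet.iInter fun _ =>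
    measurable_radSeq _ (measurableSet_singleton _)

theorem prod_one_add_eq_zero {x : ℝ} (hx : ∀ k, radSeq x k = 1 ∨ radSeq x k = -1) {s l : ℕ}
    (h : x ∉ radOnes s l) : ∏ t ∈ Finset.range l, (1 + radSeq x (s + t)) = 0 := by
  simp only [radOnes, mem_ofPred_eq, not_forall] at h
  obtain ⟨t, ht, hne⟩ := h
  refine Finset.prod_eq_zero (Finset.mem_range.2 ht) ?_
  rw [(hx (s + t)).resolve_left hne]; norm_num

theorem measureReal_radOnes (s l : ℕ) : unitMeasure.real (radOnes s l) = (1 / 2) ^ l := by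
  have h := integral_prod_one_add_radSeq s l
  have hae : (fun x => ∏ t ∈ Finset.range l, (1 + radSeq x (s + t))) =ᵐ[unitMeasure]
      (radOnes s l).indicator fun _ => (2 : ℝ) ^ l := by
    filter_upwards [ae_radSeq_eq_one_or unitMeasure] with x hx
    by_cases hm : x ∈ radOnes s l
    · rw [indicator_of_mem hm, Finset.prod_congr rfl fun t ht => by
        rw [hm t (Finset.mem_range.1 ht)]]
      norm_num
    · rw [indicator_of_notMem hm, prod_one_add_eq_zero hx hm]
  rw [integral_congr_ae hae, integral_indicator_const _ (measurableSet_radOnes s l),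
    smul_eq_mul] at h
  rw [one_div, inv_pow]
  exact eq_inv_of_mul_eq_one_left h

/-! ### Dyadic cells and approximation by cell functions -/

/-- The dyadic cell of rank `K` containing a point, as a string of signs. -/
noncomputable def dyadicCell (K : ℕ) (x : ℝ) : Fin K → Bool := fun t =>
  haveI := Classical.dec (radSeq x t = 1)
  decide (radSeq x t = 1)

/-- The `±1` sequence of a cell, continued by `1`. -/
def cellSign {K : ℕ} (b : Fin K → Bool) (t : ℕ) : ℝ :=
  if h : t < K then (if b ⟨t, h⟩ then 1 else -1) else 1

theorem cellSign_eq_one_or {K : ℕ} (b : Fin K → Bool) (t : ℕ) :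
    cellSign b t = 1 ∨ cellSign b t = -1 := by
  unfold cellSign
  split_ifs <;> simp

theorem measurable_dyadicCell (K : ℕ) : Measurable (dyadicCell K) := by
  refine measurable_pi_lambda _ fun t => measurable_to_bool ?_
  have : (fun x => dyadicCell K x t) ⁻¹' {true} = (fun x => radSeq x t) ⁻¹' {1} := by
    ext x; simp [dyadicCell]
  rw [this]
  exact measurable_radSeq _ (measurableSet_singleton _)

theorem prod_one_add_mul_cellSign {x : ℝ} (hx : ∀ k, radSeq x k = 1 ∨ radSeq x k = -1) {K : ℕ}
    (b : Fin K → Bool) :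
    ∏ t ∈ Finset.range K, (1 + radSeq x t * cellSign b t) =
      if dyadicCell K x = b then 2 ^ K else 0 := by
  have key : ∀ t (h : t < K), radSeq x t * cellSign b t =
      if dyadicCell K x ⟨t, h⟩ = b ⟨t, h⟩ then 1 else -1 := by
    intro t h
    rcases hx t with h1 | h1 <;> cases hb : b ⟨t, h⟩ <;> norm_num [cellSign, h, dyadicCell, h1, hb]
  split_ifs with hc
  · rw [Finset.prod_congr rfl fun t ht => by
      rw [key t (Finset.mem_range.1 ht), hc, if_pos rfl]]
    norm_num
  · obtain ⟨t, ht⟩ := Function.ne_iff.1 hc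
    refine Finset.prod_eq_zero (Finset.mem_range.2 t.2) ?_
    rw [key t t.2, if_neg ht]; norm_num

/-- The sign of `sin (π u)` alternates with the integer part of `u`. The signs at `x` are thus its
binary digits, which is what bounds the diameter of a cell. -/
theorem radSeq_eq_of_floor {x : ℝ} (hx : ∀ k, radSeq x k = 1 ∨ radSeq x k = -1) (k : ℕ) :
    radSeq x k = 1 ↔ Even ⌊2 ^ (k + 1) * x⌋ := by
  set u := 2 ^ (k + 1) * x with hu
  have hr : radSeq x k = Real.sign (Real.sin (Real.pi * u)) := by
    unfold radSeq rademacher; rw [hu]; ring_nf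
  have h0 := Int.floor_le u
  have h1 := Int.lt_floor_add_one u
  rcases Int.even_or_odd' ⌊u⌋ with ⟨z, hz | hz⟩
  · have hs : 0 ≤ Real.sin (Real.pi * u) := by
      have : Real.pi * u = Real.pi * (u - ⌊u⌋) + z * (2 * Real.pi) := by rw [hz]; push_cast; ring
      rw [this, Real.sin_add_int_mul_two_pi]
      apply Real.sin_nonneg_of_nonneg_of_le_pi
      · exact mul_nonneg Real.pi_pos.le (by linarith)
      · nlinarith [Real.pi_pos]
    refine iff_of_true ((hx k).resolve_right fun h => ?_) ⟨z, by omega⟩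
    rw [hr] at h
    rcases hs.eq_or_lt with h' | h'
    · rw [← h', Real.sign_zero] at h; norm_num at h
    · rw [Real.sign_of_pos h'] at h; norm_num at h
  · have hs : Real.sin (Real.pi * u) ≤ 0 := by
      have : Real.pi * u = Real.pi * (u - ⌊u⌋) + Real.pi + z * (2 * Real.pi) := by
        rw [hz]; push_cast; ring
      rw [this, Real.sin_add_int_mul_two_pi, Real.sin_add_pi, neg_nonpos]
      apply Real.sin_nonneg_of_nonneg_of_le_pi
      · exact mul_nonneg Real.pi_pos.le (by linarith)
      · nlinarith [Real.pi_pos]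
    refine iff_of_false (fun h => ?_) (by rw [Int.not_even_iff_odd]; exact ⟨z, hz⟩)
    rw [hr] at h
    rcases hs.eq_or_lt with h' | h'
    · rw [h', Real.sign_zero] at h; norm_num at h
    · rw [Real.sign_of_neg h'] at h; norm_num at h

theorem floor_two_mul_cases (y : ℝ) : ⌊2 * y⌋ = 2 * ⌊y⌋ ∨ ⌊2 * y⌋ = 2 * ⌊y⌋ + 1 := by
  have h0 := Int.floor_le y
  have h1 := Int.lt_floor_add_one y
  have h2 : 2 * ⌊y⌋ ≤ ⌊2 * y⌋ := Int.le_floor.2 (by push_cast; linarith)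
  have h3 : ⌊2 * y⌋ < 2 * ⌊y⌋ + 2 := Int.floor_lt.2 (by push_cast; linarith)
  omega

theorem lt_one_of_radSeq {x : ℝ} (hx1 : x ≤ 1) (hx : ∀ k, radSeq x k = 1 ∨ radSeq x k = -1) :
    x < 1 := by
  refine lt_of_le_of_ne hx1 ?_
  rintro rfl
  have h : radSeq 1 0 = 0 := by simp [radSeq, rademacher]
  have := hx 0
  rw [h] at this
  norm_num at this

theorem abs_sub_le_of_dyadicCell_eq {x y : ℝ} (hx01 : x ∈ Icc (0 : ℝ) 1) (hy01 : y ∈ Icc (0 : ℝ) 1)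
    (hx : ∀ k, radSeq x k = 1 ∨ radSeq x k = -1) (hy : ∀ k, radSeq y k = 1 ∨ radSeq y k = -1)
    {K : ℕ} (h : dyadicCell K x = dyadicCell K y) : |x - y| ≤ (1 / 2) ^ K := by
  -- Equal signs force equal binary digits one after another. The start `k = 0` needs both points to
  -- differ from 1, where `r_0` vanishes.
  have hfl : ∀ k ≤ K, ⌊2 ^ k * x⌋ = ⌊2 ^ k * y⌋ := by
    intro k
    induction k with
    | zero =>
      intro _
      rw [pow_zero, one_mul, one_mul, Int.floor_eq_zero_iff.2 ⟨hx01.1, lt_one_of_radSeq hx01.2 hx⟩,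
        Int.floor_eq_zero_iff.2 ⟨hy01.1, lt_one_of_radSeq hy01.2 hy⟩]
    | succ k ih =>
      intro hk
      have ih' := ih (by omega)
      have hpar : Even ⌊2 ^ (k + 1) * x⌋ ↔ Even ⌊2 ^ (k + 1) * y⌋ := by
        rw [← radSeq_eq_of_floor hx, ← radSeq_eq_of_floor hy]
        have := congrFun h ⟨k, hk⟩
        simpa [dyadicCell] using this
      have hx2 := floor_two_mul_cases (2 ^ k * x)
      have hy2 := floor_two_mul_cases (2 ^ k * y)
      rw [← mul_assoc, ← pow_succ'] at hx2 hy2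
      rw [Int.even_iff, Int.even_iff] at hpar
      omega
  have h1 := Int.abs_sub_lt_one_of_floor_eq_floor (hfl K le_rfl)
  rw [← mul_sub, abs_mul, abs_of_pos (by positivity : (0 : ℝ) < 2 ^ K)] at h1
  rw [one_div, inv_pow, ← one_div, le_div_iff₀ (by positivity)]
  linarith

/-- Functions constant on dyadic cells approximate any integrable function, with uniformly bounded
values as the rank grows. -/
theorem exists_dyadic_approx {ν : Measure ℝ} [IsFiniteMeasure ν] (hν : ν ≪ unitMeasure)
    {h : ℝ → ℝ} (hh : Integrable h ν) {ε : ℝ} (hε : 0 < ε) :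
    ∃ B : ℝ, ∃ K₀ : ℕ, ∀ K ≥ K₀, ∃ v : (Fin K → Bool) → ℝ, (∀ b, |v b| ≤ B) ∧
      ∫ x, |h x - v (dyadicCell K x)| ∂ν ≤ ε := by
  obtain ⟨g, hg, hgi⟩ := hh.exists_boundedContinuous_integral_sub_le (half_pos hε)
  have hgu := isCompact_Icc (a := (0 : ℝ)) (b := 1) |>.uniformContinuousOn_of_continuous
    g.continuous.continuousOn
  set M := ν.real univ with hM
  have hM0 : 0 ≤ M := measureReal_nonneg
  obtain ⟨d, hd, hgd⟩ := Metric.uniformContinuousOn_iff.1 hgu (ε / (2 * (M + 1))) (by positivity)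
  obtain ⟨K₀, hK₀⟩ := exists_pow_lt_of_lt_one hd (by norm_num : (1 / 2 : ℝ) < 1)
  refine ⟨‖g‖, K₀, fun K hK => ?_⟩
  classical
  let P : (Fin K → Bool) → ℝ → Prop := fun b y => y ∈ Icc (0 : ℝ) 1 ∧
    (∀ k, radSeq y k = 1 ∨ radSeq y k = -1) ∧ dyadicCell K y = b
  -- A sample of the continuous approximant in each cell, the value 0 being harmless for cells
  -- without a sample point. The bound `‖g‖` does not depend on `K`, so phase `n` can realise `v`
  -- once `n ≥ ‖g‖`.
  let v : (Fin K → Bool) → ℝ := fun b => if H : ∃ y, P b y then g H.choose else 0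
  refine ⟨v, fun b => ?_, ?_⟩
  · by_cases H : ∃ y, P b y
    · simpa [v, H] using g.norm_coe_le_norm H.choose
    · simp [v, H]
  have hvm : Measurable fun x => v (dyadicCell K x) :=
    (measurable_of_finite v).comp (measurable_dyadicCell K)
  have hvi : Integrable (fun x => v (dyadicCell K x)) ν := by
    refine hvm.integrable_of_abs_le (B := ‖g‖) fun x => ?_
    by_cases H : ∃ y, P (dyadicCell K x) y
    · simpa [v, H] using g.norm_coe_le_norm H.choose
    · simp [v, H]
  have hae : ∀ᵐ x ∂ν, |g x - v (dyadicCell K x)| ≤ ε / (2 * (M + 1)) := by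
    apply hν.ae_le
    filter_upwards [ae_radSeq_eq_one_or unitMeasure, ae_restrict_mem measurableSet_Icc] with x hx hx1
    have H : ∃ y, P (dyadicCell K x) y := ⟨x, hx1, hx, rfl⟩
    obtain ⟨c1, c2, c3⟩ := H.choose_spec
    have : v (dyadicCell K x) = g H.choose := by simp only [v]; rw [dif_pos H]
    rw [this, ← Real.dist_eq]
    refine (hgd x hx1 _ c1 ?_).le
    rw [Real.dist_eq]
    calc |x - H.choose| ≤ (1 / 2) ^ K := abs_sub_le_of_dyadicCell_eq hx1 c1 hx c2 c3.symm
      _ ≤ (1 / 2) ^ K₀ := pow_le_pow_of_le_one (by norm_num) (by norm_num) hK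
      _ < d := hK₀
  calc ∫ x, |h x - v (dyadicCell K x)| ∂ν
      ≤ ∫ x, (|h x - g x| + |g x - v (dyadicCell K x)|) ∂ν :=
        integral_mono (hh.sub hvi).abs ((hh.sub hgi).abs.add (hgi.sub hvi).abs)
          fun x => abs_sub_le _ _ _
    _ = ∫ x, |h x - g x| ∂ν + ∫ x, |g x - v (dyadicCell K x)| ∂ν :=
        integral_add (hh.sub hgi).abs (hgi.sub hvi).abs
    _ ≤ ε / 2 + ∫ x, ε / (2 * (M + 1)) ∂ν :=
        add_le_add hg (integral_mono_ae (hgi.sub hvi).abs (integrable_const _) hae)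
    _ = ε / 2 + M * (ε / (2 * (M + 1))) := by rw [integral_const, smul_eq_mul]
    _ ≤ ε := by
        have : M * (ε / (2 * (M + 1))) ≤ ε / 2 := by
          rw [mul_div_assoc', div_le_div_iff₀ (by positivity) (by norm_num)]
          nlinarith
        linarith

/-! ### Numerical parameters -/

/-- The index of the interval `[I n, I (n + 1))` containing `k`. -/
def levelIndex (I : ℕ → ℕ) (k : ℕ) : ℕ := Nat.findGreatest (fun n => I n ≤ k) k

theorem levelIndex_eq {I : ℕ → ℕ} (hI : StrictMono I) {n k : ℕ} (h1 : I n ≤ k)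
    (h2 : k < I (n + 1)) : levelIndex I k = n := by
  refine Nat.findGreatest_eq_iff.2 ⟨(hI.le_apply).trans h1, fun _ => h1, fun m hm _ => ?_⟩
  have := hI.monotone (Nat.succ_le_of_lt hm)
  exact not_le.2 (h2.trans_le this)

theorem levelIndex_mono (I : ℕ → ℕ) {j k : ℕ} (h : j ≤ k) : levelIndex I j ≤ levelIndex I k :=
  Nat.findGreatest_mono (fun _ hn => hn.trans h) h

theorem levelIndex_spec {I : ℕ → ℕ} (hI : StrictMono I) {k : ℕ} (h : I 0 ≤ k) :
    I (levelIndex I k) ≤ k ∧ k < I (levelIndex I k + 1) := by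
  refine ⟨Nat.findGreatest_spec (P := fun n => I n ≤ k) (Nat.zero_le k) h, ?_⟩
  by_contra hc
  have h1 : I (levelIndex I k + 1) ≤ k := not_lt.1 hc
  have := Nat.le_findGreatest (P := fun n => I n ≤ k) ((hI.le_apply).trans h1) h1
  simp only [levelIndex] at this
  omega

/-- The numerical data of the construction: the `i`-th step uses the frequencies in
`[2 ^ s i, 2 ^ s (i + 1))` with coefficients close to `C i`; the `n`-th phase consists of the steps
in `[I n, I (n + 1))` and works with dyadic cells of rank `κ + n`. -/
structure WalshScheme where
  κ : ℕ
  s : ℕ → ℕ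
  l : ℕ → ℕ
  I : ℕ → ℕ
  C : ℕ → ℝ
  s_succ : ∀ i, s (i + 1) = s i + l i
  l_pos : ∀ i, 0 < l i
  le_s : ∀ i, κ + i ≤ s i
  I_zero : I 0 = 0
  I_strictMono : StrictMono I
  C_pos : ∀ i, 0 < C i
  C_anti : Antitone C
  C_sum : ∀ n : ℕ, (n : ℝ) ≤ ∑ i ∈ Finset.Ico (I n) (I (n + 1)), C i
  C_small : ∀ n i, I n ≤ i → i < I (n + 1) →
    C i * (s (i + 1) + 2 + 2 ^ (κ + n) * (2 * l i + 6)) ≤ 11 * (1 / 2) ^ n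
  l_summable : Summable fun i => (1 / 2 : ℝ) ^ l i

/-- Cauchy condensation reduces the series to the harmonic one. -/
theorem not_summable_one_div_mul_clog :
    ¬ Summable fun n : ℕ => 1 / ((n : ℝ) * (Nat.clog 2 n + 1)) := by
  rw [← summable_condensed_iff_of_nonneg (fun n => by positivity)]
  · intro h
    have h2 : Summable fun k : ℕ => 1 / ((k + 1 : ℕ) : ℝ) := by
      refine h.congr fun k => ?_
      rw [Nat.clog_pow 2 k (by norm_num)]
      push_cast
      field_simp
    exact Real.not_summable_one_div_natCast ((summable_nat_add_iff 1).1 h2)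
  · intro m n hm hmn
    have h1 : (m : ℝ) ≤ n := by exact_mod_cast hmn
    have h2 : (Nat.clog 2 m : ℝ) ≤ Nat.clog 2 n := by exact_mod_cast Nat.clog_mono_right 2 hmn
    have h3 : (0 : ℝ) < m := by exact_mod_cast hm
    have := h3.trans_le h1
    gcongr

theorem half_pow_clog_le (i : ℕ) : (1 / 2 : ℝ) ^ (2 * Nat.clog 2 (i + 1)) ≤ 1 / ((i : ℝ) + 1) ^ 2 := by
  have h : ((i : ℝ) + 1) ≤ 2 ^ Nat.clog 2 (i + 1) := by
    exact_mod_cast Nat.le_pow_clog (by norm_num : 1 < 2) (i + 1)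
  rw [mul_comm, pow_mul, one_div_pow, one_div_pow]
  exact one_div_le_one_div_of_le (by positivity) (pow_le_pow_left₀ (by positivity) h 2)

theorem summable_half_pow_clog : Summable fun i : ℕ => (1 / 2 : ℝ) ^ (2 * Nat.clog 2 (i + 1)) := by
  refine Summable.of_nonneg_of_le (fun i => by positivity) half_pow_clog_le ?_
  have := (summable_nat_add_iff 1).2 (Real.summable_one_div_nat_pow.2 (by norm_num : 1 < 2))
  refine this.congr fun i => ?_
  push_cast
  rfl

theorem exists_walshScheme {δ : ℝ} (hδ : 0 < δ) :
    ∃ S : WalshScheme, (1 / 2) ^ S.κ + ∑' i, (1 / 2 : ℝ) ^ S.l i < δ := by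
  have hsum0 := summable_half_pow_clog
  set A := ∑' i : ℕ, (1 / 2 : ℝ) ^ (2 * Nat.clog 2 (i + 1))
  have hA : 0 ≤ A := tsum_nonneg fun i => by positivity
  obtain ⟨κ, hκ⟩ := exists_pow_lt_of_lt_one (show 0 < δ / (1 + A) by positivity)
    (by norm_num : (1 / 2 : ℝ) < 1)
  -- The factor 2 makes `2^-l` comparable to a summable `(i+1)^-2`, the shift by `κ` multiplies the
  -- sum by at most `2^-κ`, and the final 1 makes every length positive.
  set l : ℕ → ℕ := fun i => 2 * Nat.clog 2 (i + 1) + κ + 1 with hl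
  set s : ℕ → ℕ := fun i => κ + ∑ j ∈ Finset.range i, l j with hs
  have hs_succ : ∀ i, s (i + 1) = s i + l i := fun i => by
    simp only [hs, Finset.sum_range_succ]; ring
  have hs_le : ∀ i, κ + i ≤ s i := fun i => by
    induction i with
    | zero => simp [hs]
    | succ i ih => rw [hs_succ]; simp only [hl]; omega
  have hl_mono : Monotone l := fun i j h => by
    have := Nat.clog_mono_right 2 (Nat.succ_le_succ h)
    simp only [hl]
    simp only [Nat.succ_eq_add_one] at this
    omega
  have hs_up : ∀ i, s (i + 1) ≤ (2 * κ + 2) * ((i + 1) * (Nat.clog 2 (i + 1) + 1)) := fun i => by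
    have h1 : ∑ j ∈ Finset.range (i + 1), l j ≤ (i + 1) * l i := by
      have := Finset.sum_le_card_nsmul (Finset.range (i + 1)) l (l i) fun j hj =>
        hl_mono (Nat.lt_succ_iff.1 (Finset.mem_range.1 hj))
      simpa using this
    have h2 : s (i + 1) ≤ κ + (i + 1) * l i := Nat.add_le_add_left h1 κ
    refine h2.trans ?_
    simp only [hl]
    nlinarith [Nat.zero_le (i * Nat.clog 2 (i + 1)), Nat.zero_le (κ * i * Nat.clog 2 (i + 1)),
      Nat.zero_le (κ * Nat.clog 2 (i + 1)), Nat.zero_le (κ * i)]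
  -- The steps are still short enough: `s (i+1)` is at most a multiple of `(i+1)(log(i+1)+1)`.
  have hdiv : ¬ Summable fun i => 1 / (s (i + 1) : ℝ) := fun h => by
    apply not_summable_one_div_mul_clog
    rw [← summable_nat_add_iff 1]
    refine Summable.of_nonneg_of_le (fun i => by positivity) (fun i => ?_)
      (h.mul_left (2 * κ + 2 : ℝ))
    have h1 : (s (i + 1) : ℝ) ≤ (2 * κ + 2) * ((i + 1) * (Nat.clog 2 (i + 1) + 1)) := by
      exact_mod_cast hs_up i
    have h2 : (0 : ℝ) < s (i + 1) := by
      have := hs_le (i + 1); exact_mod_cast (by omega : 0 < s (i + 1))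
    rw [mul_one_div, div_le_div_iff₀ (by positivity) h2]
    push_cast
    linarith
  -- By divergence, a phase can be prolonged until its coefficients sum to at least `n`, despite the
  -- factor `4^-(κ+n)`. One half of that factor will offset the cell height `2^(κ+n)`, the other
  -- will give the decay `2^-n`.
  have hnext : ∀ n a : ℕ, ∃ b, a < b ∧
      (n : ℝ) ≤ ∑ i ∈ Finset.Ico a b, (1 / 4 : ℝ) ^ (κ + n) / s (i + 1) := by
    intro n a
    have ht := (not_summable_iff_tendsto_nat_atTop_of_nonneg (fun i => by positivity)).1
      (fun h => hdiv ((summable_nat_add_iff a).1 h))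
    obtain ⟨N, hN⟩ := ((ht.eventually_ge_atTop (n * 4 ^ (κ + n))).and
      (eventually_gt_atTop 0)).exists
    refine ⟨a + N, by omega, ?_⟩
    rw [Finset.sum_Ico_eq_sum_range, Nat.add_sub_cancel_left]
    simp only [div_eq_mul_inv (((1 : ℝ) / 4) ^ (κ + n)) _, ← Finset.mul_sum]
    have h1 := hN.1
    rw [one_div_pow, one_div, inv_mul_eq_div, le_div_iff₀ (by positivity)]
    refine h1.trans (Finset.sum_le_sum fun i _ => ?_)
    rw [one_div, show i + a + 1 = a + i + 1 by ring]
  choose nx hnx1 hnx2 using hnext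
  let I : ℕ → ℕ := fun n => Nat.rec 0 (fun n a => nx n a) n
  have hI : StrictMono I := strictMono_nat_of_lt_succ fun n => hnx1 n (I n)
  have hI_sum : ∀ n : ℕ,
      (n : ℝ) ≤ ∑ i ∈ Finset.Ico (I n) (I (n + 1)), (1 / 4 : ℝ) ^ (κ + n) / s (i + 1) :=
    fun n => hnx2 n (I n)
  have hs_pos : ∀ i, (0 : ℝ) < s (i + 1) := fun i => by
    have := hs_le (i + 1); exact_mod_cast (by omega : 0 < s (i + 1))
  have hl_sum : ∀ i, (1 / 2 : ℝ) ^ l i ≤ (1 / 2) ^ κ * (1 / 2 : ℝ) ^ (2 * Nat.clog 2 (i + 1)) :=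
    fun i => by
      rw [← pow_add]
      exact pow_le_pow_of_le_one (by norm_num) (by norm_num) (by simp only [hl]; omega)
  have hl_summable : Summable fun i => (1 / 2 : ℝ) ^ l i :=
    Summable.of_nonneg_of_le (fun i => by positivity) hl_sum (hsum0.mul_left _)
  refine ⟨{
    κ := κ, s := s, l := l, I := I
    C := fun i => (1 / 4 : ℝ) ^ (κ + levelIndex I i) / s (i + 1)
    s_succ := hs_succ
    l_pos := fun i => by simp [hl]
    le_s := hs_le
    I_zero := rfl
    I_strictMono := hI
    C_pos := fun i => div_pos (by positivity) (hs_pos i)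
    C_anti := fun i j h => ?_
    C_sum := fun n => ?_
    C_small := fun n i h1 h2 => ?_
    l_summable := hl_summable }, ?_⟩
  · have h1 : (s (i + 1) : ℝ) ≤ s (j + 1) := by
      have : Monotone s := monotone_nat_of_le_succ fun i => by rw [hs_succ]; omega
      exact_mod_cast this (Nat.succ_le_succ h)
    have h2 := hs_pos i
    have h3 : (1 / 4 : ℝ) ^ (κ + levelIndex I j) ≤ (1 / 4) ^ (κ + levelIndex I i) :=
      pow_le_pow_of_le_one (by norm_num) (by norm_num)
        (Nat.add_le_add_left (levelIndex_mono I h) κ)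
    dsimp only
    gcongr
  · refine (hI_sum n).trans (Finset.sum_le_sum fun i hi => ?_)
    rw [Finset.mem_Ico] at hi
    rw [levelIndex_eq hI hi.1 hi.2]
  · rw [levelIndex_eq hI h1 h2, div_mul_eq_mul_div, div_le_iff₀ (hs_pos i)]
    have h3 : (l i : ℝ) ≤ s (i + 1) := by
      rw [hs_succ]; push_cast; linarith [(Nat.cast_nonneg (s i) : (0 : ℝ) ≤ s i)]
    have h4 : (1 : ℝ) ≤ s (i + 1) := by
      have := hs_le (i + 1); exact_mod_cast (by omega : 1 ≤ s (i + 1))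
    have h5 : (1 : ℝ) ≤ 2 ^ (κ + n) := one_le_pow₀ (by norm_num)
    -- The constant is `11 = 1 + 2 + 2 + 6`, from `l i ≤ s (i+1)`, `1 ≤ s (i+1)` and `1 ≤ 2^(κ+n)`.
    have h6 : ((s (i + 1) : ℝ) + 2 + 2 ^ (κ + n) * (2 * l i + 6)) ≤
        2 ^ (κ + n) * (11 * s (i + 1)) := by nlinarith
    have h7 : (1 / 4 : ℝ) ^ (κ + n) * 2 ^ (κ + n) ≤ (1 / 2) ^ n := by
      rw [← mul_pow]
      norm_num only
      exact pow_le_pow_of_le_one (by norm_num) (by norm_num) (by omega)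
    calc _ ≤ (1 / 4 : ℝ) ^ (κ + n) * (2 ^ (κ + n) * (11 * s (i + 1))) := by gcongr
      _ = ((1 / 4 : ℝ) ^ (κ + n) * 2 ^ (κ + n)) * (11 * s (i + 1)) := by ring
      _ ≤ (1 / 2) ^ n * (11 * s (i + 1)) := by gcongr
      _ = _ := by ring
  · calc (1 / 2 : ℝ) ^ κ + ∑' i, (1 / 2 : ℝ) ^ l i ≤ (1 / 2) ^ κ + (1 / 2) ^ κ * A := by
          rw [← tsum_mul_left]
          exact add_le_add le_rfl (hl_summable.tsum_le_tsum hl_sum (hsum0.mul_left _))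
      _ = (1 / 2) ^ κ * (1 + A) := by ring
      _ < δ := by rwa [lt_div_iff₀ (by positivity)] at hκ

/-! ### Signed Walsh sums over one step -/

theorem Finset.sum_Ico_eq_sub_range {m n : ℕ} (f : ℕ → ℝ) (h : m ≤ n) :
    ∑ k ∈ Finset.Ico m n, f k = ∑ k ∈ Finset.range n, f k - ∑ k ∈ Finset.range m, f k :=
  Finset.sum_Ico_eq_sub f h

/-- Writing `k = 2^s p + j` separates the variables, since the signs see only `j`. The `-1` removes
the block `p = 0`, which lies below the step. -/
theorem sum_Ico_periodic_mul_wal (r φ : ℕ → ℝ) (s l : ℕ) :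
    ∑ k ∈ Finset.Ico (2 ^ s) (2 ^ (s + l)), φ (k % 2 ^ s) * wal r k =
      (∏ t ∈ Finset.range l, (1 + r (s + t)) - 1) *
        ∑ j ∈ Finset.range (2 ^ s), φ j * wal r j := by
  have hblock : ∀ q, ∑ k ∈ Finset.range (2 ^ s * q + 0), φ (k % 2 ^ s) * wal r k =
      (∑ p ∈ Finset.range q, wal r (2 ^ s * p)) *
        ∑ j ∈ Finset.range (2 ^ s), φ j * wal r j := by
    intro q
    rw [sum_range_two_pow_mul_add, Finset.sum_range_zero, add_zero, Finset.sum_mul]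
    refine Finset.sum_congr rfl fun p _ => ?_
    rw [Finset.mul_sum]
    refine Finset.sum_congr rfl fun j hj => ?_
    have hj' := Finset.mem_range.1 hj
    rw [wal_shift_add r p hj', Nat.mul_add_mod, Nat.mod_eq_of_lt hj']
    ring
  have h1 := hblock (2 ^ l)
  have h2 := hblock 1
  rw [add_zero, ← pow_add, sum_range_wal_shift] at h1
  simp only [add_zero, mul_one, Finset.sum_range_one, mul_zero, wal_zero, one_mul] at h2
  rw [Finset.sum_Ico_eq_sub_range _ (Nat.pow_le_pow_right (by norm_num) (Nat.le_add_right s l)),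
    h1, h2]
  ring

theorem abs_sum_mul_le_of_support {r χ : ℕ → ℝ} (hr : ∀ k, |wal r k| ≤ 1) {N : ℕ}
    (hχ : ∀ j, |χ j| ≤ 2) (hχ0 : ∀ j, N ≤ j → χ j = 0) (m : ℕ) :
    |∑ j ∈ Finset.range m, χ j * wal r j| ≤ 2 * N := by
  calc |∑ j ∈ Finset.range m, χ j * wal r j|
      ≤ ∑ j ∈ Finset.range m, |χ j * wal r j| := Finset.abs_sum_le_sum_abs _ _
    _ ≤ ∑ j ∈ Finset.range m, if j < N then (2 : ℝ) else 0 := by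
        refine Finset.sum_le_sum fun j _ => ?_
        split_ifs with h
        · rw [abs_mul]
          exact (mul_le_of_le_one_right (abs_nonneg _) (hr j)).trans (hχ j)
        · rw [hχ0 j (not_lt.1 h)]; simp
    _ = ((Finset.range m).filter (· < N)).card * 2 := by
        rw [← Finset.sum_filter, Finset.sum_const, nsmul_eq_mul]
    _ ≤ N * 2 := by
        have : ((Finset.range m).filter (· < N)).card ≤ N := by
          have h := Finset.card_le_card (s := (Finset.range m).filter (· < N))
            (t := Finset.range N) fun j hj => by
              simpa using (Finset.mem_filter.1 hj).2
          simpa using h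
        have : (((Finset.range m).filter (· < N)).card : ℝ) ≤ N := by exact_mod_cast this
        linarith
    _ = 2 * N := mul_comm _ _

/-- `L¹` bound for the partial sums of a step whose signs differ from `1` only at low residues. -/
theorem integral_abs_sum_periodic_le {s l K m : ℕ} {φ : ℕ → ℝ} (hφ : ∀ j, |φ j| ≤ 1)
    (hφ1 : ∀ j, 2 ^ K ≤ j → φ j = 1) (hm1 : 2 ^ s ≤ m) (hm2 : m ≤ 2 ^ (s + l)) :
    ∫ x, |∑ k ∈ Finset.Ico (2 ^ s) m, φ (k % 2 ^ s) * walsh k x| ∂unitMeasure ≤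
      (s + l : ℕ) + 2 + 2 ^ K * (2 * l + 6) := by
  set q := m / 2 ^ s
  set j := m % 2 ^ s
  have hmq : m = 2 ^ s * q + j := (Nat.div_add_mod m _).symm
  have hj : j < 2 ^ s := Nat.mod_lt _ (by positivity)
  have hq : q ≤ 2 ^ l := by
    refine Nat.div_le_of_le_mul ?_
    rwa [← pow_add]
  -- Split `φ = 1 + χ`. The constant part gives a difference of two Dirichlet kernels; `χ` lives on
  -- fewer than `2^K + 1` residues, so its inner sums are bounded by `2 * 2^K` and the outer one is
  -- a dilated kernel of norm at most `l + 1`. Hence `2^K` multiplies `l` but not `s`.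
  set χ : ℕ → ℝ := fun j => φ j - 1
  have hχ : ∀ j, |χ j| ≤ 2 := fun j => by
    have := abs_le.1 (hφ j)
    exact abs_le.2 ⟨by simp only [χ]; linarith, by simp only [χ]; linarith⟩
  have hχ0 : ∀ j, 2 ^ K ≤ j → χ j = 0 := fun j h => by simp [χ, hφ1 j h]
  have hpt : ∀ x, |∑ k ∈ Finset.Ico (2 ^ s) m, φ (k % 2 ^ s) * walsh k x| ≤
      |∑ k ∈ Finset.range m, walsh (2 ^ 0 * k) x| + ∏ t ∈ Finset.range s, (1 + radSeq x (0 + t)) +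
        (2 * 2 ^ K * |∑ p ∈ Finset.range q, walsh (2 ^ s * p) x| + 4 * 2 ^ K) := by
    intro x
    set r := radSeq x
    have hr : ∀ k, |wal r k| ≤ 1 := abs_wal_le_one (abs_radSeq_le_one x)
    have hY : ∀ n, |∑ i ∈ Finset.range n, χ i * wal r i| ≤ 2 * 2 ^ K := fun n => by
      exact_mod_cast abs_sum_mul_le_of_support hr hχ hχ0 n
    have hlow : ∀ n p, n ≤ 2 ^ s → ∑ i ∈ Finset.range n,
        χ ((2 ^ s * p + i) % 2 ^ s) * wal r (2 ^ s * p + i) =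
        wal r (2 ^ s * p) * ∑ i ∈ Finset.range n, χ i * wal r i := by
      intro n p hn
      rw [Finset.mul_sum]
      refine Finset.sum_congr rfl fun i hi => ?_
      have hi' := (Finset.mem_range.1 hi).trans_le hn
      rw [wal_shift_add r p hi', Nat.mul_add_mod, Nat.mod_eq_of_lt hi']
      ring
    have hχsum : ∑ k ∈ Finset.Ico (2 ^ s) m, χ (k % 2 ^ s) * wal r k =
        (∑ p ∈ Finset.range q, wal r (2 ^ s * p)) *
          ∑ i ∈ Finset.range (2 ^ s), χ i * wal r i +
        wal r (2 ^ s * q) * ∑ i ∈ Finset.range j, χ i * wal r i -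
        ∑ i ∈ Finset.range (2 ^ s), χ i * wal r i := by
      rw [Finset.sum_Ico_eq_sub_range _ hm1]
      have h0 := hlow (2 ^ s) 0 le_rfl
      simp only [mul_zero, zero_add, wal_zero, one_mul] at h0
      rw [h0]
      congr 1
      conv_lhs => rw [hmq]
      rw [sum_range_two_pow_mul_add, hlow j q hj.le, Finset.sum_mul]
      congr 1
      exact Finset.sum_congr rfl fun p _ => hlow _ p le_rfl
    have hsplit : ∑ k ∈ Finset.Ico (2 ^ s) m, φ (k % 2 ^ s) * walsh k x =
        ∑ k ∈ Finset.range m, walsh (2 ^ 0 * k) x -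
          ∏ t ∈ Finset.range s, (1 + radSeq x (0 + t)) +
        ∑ k ∈ Finset.Ico (2 ^ s) m, χ (k % 2 ^ s) * wal r k := by
      rw [← sum_range_wal_shift]
      simp only [pow_zero, one_mul, ← walsh_eq]
      rw [← Finset.sum_Ico_eq_sub_range _ hm1, ← Finset.sum_add_distrib]
      refine Finset.sum_congr rfl fun k _ => ?_
      simp only [χ, walsh_eq]
      ring
    rw [hsplit, hχsum]
    have hP : 0 ≤ ∏ t ∈ Finset.range s, (1 + radSeq x (0 + t)) :=
      prod_one_add_radSeq_nonneg x _ _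
    have e1 : |(∑ p ∈ Finset.range q, wal r (2 ^ s * p)) *
        ∑ i ∈ Finset.range (2 ^ s), χ i * wal r i| ≤
        2 * 2 ^ K * |∑ p ∈ Finset.range q, walsh (2 ^ s * p) x| := by
      rw [abs_mul, mul_comm]
      exact mul_le_mul_of_nonneg_right (hY _) (abs_nonneg _)
    have e2 : |wal r (2 ^ s * q) * ∑ i ∈ Finset.range j, χ i * wal r i| ≤ 2 * 2 ^ K := by
      rw [abs_mul]
      exact (mul_le_of_le_one_left (abs_nonneg _) (hr _)).trans (hY j)
    have e3 := hY (2 ^ s)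
    refine (abs_add_le _ _).trans (add_le_add ?_ ?_)
    · refine (abs_sub _ _).trans ?_
      rw [abs_of_nonneg hP]
    · refine (abs_sub _ _).trans ?_
      refine (add_le_add (abs_add_le _ _) le_rfl).trans ?_
      linarith
  have hint : ∀ n u, Integrable (fun x => |∑ k ∈ Finset.range n, walsh (2 ^ u * k) x|) unitMeasure :=
    fun n u => (integrable_finsetSum _ fun k _ => integrable_walsh _ _).abs
  have i1 := (hint m 0).add (integrable_prod_one_add_radSeq unitMeasure 0 s)
  have i2 := ((hint q s).const_mul (2 * 2 ^ K)).add (integrable_const (4 * 2 ^ K : ℝ))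
  have b1 := integral_abs_sum_walsh_shift_le 0 hm2
  have b2 := integral_abs_sum_walsh_shift_le s hq
  have b3 := integral_prod_one_add_radSeq 0 s
  calc _ ≤ _ := integral_mono (integrable_sum_walsh _ _ _).abs (i1.add i2) hpt
    _ = ∫ x, |∑ k ∈ Finset.range m, walsh (2 ^ 0 * k) x| ∂unitMeasure + 1 +
        (2 * 2 ^ K * ∫ x, |∑ p ∈ Finset.range q, walsh (2 ^ s * p) x| ∂unitMeasure +
          4 * 2 ^ K) := by
        rw [integral_add' i1 i2, integral_add' (hint m 0) (integrable_prod_one_add_radSeq _ 0 s), b3,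
          integral_add' ((hint q s).const_mul _) (integrable_const _), integral_const_mul,
          integral_const]
        simp
    _ ≤ ((s + l : ℕ) + 1) + 1 + (2 * 2 ^ K * (l + 1) + 4 * 2 ^ K) := by gcongr
    _ = _ := by ring

/-- Signs for one step: the sum over the step's frequencies is, off a small set which does not
depend on the choice, a multiple of the indicator of a prescribed dyadic cell. -/
theorem exists_step_signs {s l K : ℕ} (hKs : K ≤ s) (b : Fin K → Bool) {τ : ℝ}
    (hτ : τ = 0 ∨ τ = 1 ∨ τ = -1) :
    ∃ ψ : ℕ → ℝ, (∀ k, ψ k = 1 ∨ ψ k = -1) ∧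
      (∀ x, (∀ k, radSeq x k = 1 ∨ radSeq x k = -1) → x ∉ radOnes 0 K ∪ radOnes s l →
        ∑ k ∈ Finset.Ico (2 ^ s) (2 ^ (s + l)), ψ k * walsh k x =
          τ * if dyadicCell K x = b then 2 ^ K else 0) ∧
      ∀ m, 2 ^ s ≤ m → m ≤ 2 ^ (s + l) →
        ∫ x, |∑ k ∈ Finset.Ico (2 ^ s) m, ψ k * walsh k x| ∂unitMeasure ≤
          (s + l : ℕ) + 2 + 2 ^ K * (2 * l + 6) := by
  have hle : 2 ^ K ≤ 2 ^ s := Nat.pow_le_pow_right (by norm_num) hKs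
  have hprod : ∀ x, (∀ k, radSeq x k = 1 ∨ radSeq x k = -1) → x ∉ radOnes 0 K →
      ∀ n, K ≤ n → ∏ t ∈ Finset.range n, (1 + radSeq x t) = 0 := by
    intro x hx h n hn
    have := prod_one_add_eq_zero hx (s := 0) (l := n) fun h' =>
      h fun t ht => h' t (ht.trans_le hn)
    simpa using this
  by_cases h0 : τ = 0
  · refine ⟨fun _ => 1, fun _ => Or.inl rfl, fun x hx hxe => ?_, fun m hm1 hm2 => ?_⟩
    · rw [mem_union, not_or] at hxe
      have := sum_Ico_periodic_mul_wal (radSeq x) (fun _ => 1) s l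
      simp only [walsh_eq]
      rw [this, prod_one_add_eq_zero hx hxe.2, h0]
      simp only [one_mul]
      rw [sum_range_wal, hprod x hx hxe.1 s hKs]
      simp
    · exact integral_abs_sum_periodic_le (φ := fun _ => 1) (fun _ => by simp) (fun _ _ => rfl)
        hm1 hm2
  · replace hτ := hτ.resolve_left h0
    -- The low residues carry the kernel translated to the cell `b`; the leading minus cancels the
    -- `-1` of the factorization. The remaining residues give a difference of kernels vanishing off
    -- `radOnes 0 K`.
    set φ : ℕ → ℝ := fun j => if j < 2 ^ K then -τ * wal (cellSign b) j else 1 with hφ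
    have hφ1 : ∀ j, φ j = 1 ∨ φ j = -1 := by
      intro j
      simp only [hφ]
      split_ifs
      · rcases hτ with h | h <;> rcases wal_eq_one_or (cellSign_eq_one_or b) j with h' | h' <;>
          simp [h, h']
      · simp
    refine ⟨fun k => φ (k % 2 ^ s), fun k => hφ1 _, fun x hx hxe => ?_, fun m hm1 hm2 => ?_⟩
    · rw [mem_union, not_or] at hxe
      simp only [walsh_eq]
      rw [sum_Ico_periodic_mul_wal (radSeq x) φ s l, prod_one_add_eq_zero hx hxe.2]
      have hsum : ∑ j ∈ Finset.range (2 ^ s), φ j * wal (radSeq x) j =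
          -τ * ∑ j ∈ Finset.range (2 ^ K), wal (radSeq x) j * wal (cellSign b) j +
          (∑ j ∈ Finset.range (2 ^ s), wal (radSeq x) j -
            ∑ j ∈ Finset.range (2 ^ K), wal (radSeq x) j) := by
        rw [← Finset.sum_range_add_sum_Ico _ hle, ← Finset.sum_Ico_eq_sub_range _ hle, Finset.mul_sum]
        congr 1
        · refine Finset.sum_congr rfl fun j hj => ?_
          simp only [hφ, if_pos (Finset.mem_range.1 hj)]
          ring
        · refine Finset.sum_congr rfl fun j hj => ?_
          simp only [hφ, if_neg (not_lt.2 (Finset.mem_Ico.1 hj).1), one_mul]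
      rw [hsum, sum_range_wal, sum_range_wal, hprod x hx hxe.1 s hKs, hprod x hx hxe.1 K le_rfl,
        Finset.sum_congr rfl fun j _ => (wal_mul (radSeq x) (cellSign b) j).symm, sum_range_wal,
        prod_one_add_mul_cellSign hx]
      ring
    · refine integral_abs_sum_periodic_le (φ := φ) (fun j => ?_) (fun j hj => ?_) hm1 hm2
      · rcases hφ1 j with h | h <;> simp [h]
      · simp only [hφ, if_neg (not_lt.2 hj)]

/-! ### Coefficients, exceptional sets and the weight -/

namespace WalshScheme

variable (S : WalshScheme)

/-- The phase to which a step belongs. -/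
def phase (i : ℕ) : ℕ := levelIndex S.I i

/-- The rank of the dyadic cells used in a step. -/
def rank (i : ℕ) : ℕ := S.κ + S.phase i

/-- The exceptional set of a step. -/
def exc (i : ℕ) : Set ℝ := radOnes 0 (S.rank i) ∪ radOnes (S.s i) (S.l i)

/-- The frequencies of a step. -/
def block (i : ℕ) : Finset ℕ := Finset.Ico (2 ^ S.s i) (2 ^ S.s (i + 1))

/-- The step to which a frequency belongs. -/
def step (k : ℕ) : ℕ := levelIndex (fun i => 2 ^ S.s i) k

/-- The Fourier–Walsh coefficients of the universal function. -/
noncomputable def coeff (k : ℕ) : ℝ := S.C (S.step k) + (1 / 2) ^ k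

/-- The factor by which the weight is reduced on an exceptional set. -/
noncomputable def penalty (i : ℕ) : ℝ :=
  2 ^ i * (∑ k ∈ S.block i, S.coeff k + S.C i * 2 ^ S.rank i)

/-- The weight. -/
noncomputable def weight (x : ℝ) : ℝ :=
  (1 + (∑' i, (S.exc i).indicator (fun _ => ENNReal.ofReal (S.penalty i)) x).toReal)⁻¹

theorem s_strictMono : StrictMono S.s :=
  strictMono_nat_of_lt_succ fun i => by have := S.l_pos i; rw [S.s_succ]; omega

theorem two_pow_s_strictMono : StrictMono fun i => 2 ^ S.s i :=
  fun _ _ h => Nat.pow_lt_pow_right (by norm_num) (S.s_strictMono h)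

theorem phase_eq {n i : ℕ} (h1 : S.I n ≤ i) (h2 : i < S.I (n + 1)) : S.phase i = n :=
  levelIndex_eq S.I_strictMono h1 h2

theorem phase_spec (i : ℕ) : S.I (S.phase i) ≤ i ∧ i < S.I (S.phase i + 1) :=
  levelIndex_spec S.I_strictMono (by simp [S.I_zero])

theorem phase_le (i : ℕ) : S.phase i ≤ i := Nat.findGreatest_le i

theorem tendsto_phase : Tendsto S.phase atTop atTop :=
  tendsto_atTop_mono' _ (Eventually.of_forall fun _ => le_rfl)
    (Monotone.tendsto_atTop_atTop (fun _ _ h => levelIndex_mono _ h)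
      fun n => ⟨S.I n, (S.phase_eq le_rfl (S.I_strictMono (Nat.lt_succ_self n))).ge⟩)

theorem rank_le (i : ℕ) : S.rank i ≤ S.s i :=
  (Nat.add_le_add_left (S.phase_le i) _).trans (S.le_s i)

theorem step_eq {i k : ℕ} (h : k ∈ S.block i) : S.step k = i :=
  levelIndex_eq S.two_pow_s_strictMono (Finset.mem_Ico.1 h).1 (Finset.mem_Ico.1 h).2

theorem mem_block_step {k : ℕ} (h : 2 ^ S.s 0 ≤ k) : k ∈ S.block (S.step k) :=
  Finset.mem_Ico.2 (levelIndex_spec S.two_pow_s_strictMono h)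

theorem coeff_eq {i k : ℕ} (h : k ∈ S.block i) : S.coeff k = S.C i + (1 / 2) ^ k := by
  rw [coeff, S.step_eq h]

theorem coeff_pos (k : ℕ) : 0 < S.coeff k := add_pos (S.C_pos _) (by positivity)

theorem coeff_strictAnti : StrictAnti S.coeff := by
  refine strictAnti_nat_of_succ_lt fun k => add_lt_add_of_le_of_lt
    (S.C_anti (levelIndex_mono _ (Nat.le_succ k))) ?_
  exact pow_lt_pow_right_of_lt_one₀ (by norm_num) (by norm_num) (Nat.lt_succ_self k)

theorem C_mul_le (i : ℕ) :
    S.C i * ((S.s i + S.l i : ℕ) + 2 + 2 ^ S.rank i * (2 * S.l i + 6)) ≤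
      11 * (1 / 2) ^ S.phase i := by
  have := S.C_small (S.phase i) i (S.phase_spec i).1 (S.phase_spec i).2
  rwa [S.s_succ] at this

theorem C_mul_two_pow_rank_le (i : ℕ) : S.C i * 2 ^ S.rank i ≤ 2 * (1 / 2) ^ S.phase i := by
  have h := S.C_mul_le i
  have h1 : S.C i * (2 ^ S.rank i * 6) ≤
      S.C i * ((S.s i + S.l i : ℕ) + 2 + 2 ^ S.rank i * (2 * S.l i + 6)) := by
    refine mul_le_mul_of_nonneg_left ?_ (S.C_pos i).le
    have h2 : (0 : ℝ) ≤ (S.s i + S.l i : ℕ) := Nat.cast_nonneg _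
    have h3 : (0 : ℝ) ≤ 2 ^ S.rank i * (2 * S.l i) := by positivity
    linarith
  have h4 : (0 : ℝ) < (1 / 2) ^ S.phase i := by positivity
  linarith

theorem tendsto_C : Tendsto S.C atTop (𝓝 0) := by
  have h := ((tendsto_pow_atTop_nhds_zero_of_lt_one (by norm_num : (0 : ℝ) ≤ 1 / 2)
    (by norm_num)).comp S.tendsto_phase).const_mul 2
  rw [mul_zero] at h
  refine squeeze_zero (fun i => (S.C_pos i).le) (fun i => ?_) h
  exact (le_mul_of_one_le_right (S.C_pos i).le (one_le_pow₀ (by norm_num))).trans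
    (S.C_mul_two_pow_rank_le i)

theorem tendsto_step : Tendsto S.step atTop atTop :=
  Monotone.tendsto_atTop_atTop (fun _ _ h => levelIndex_mono _ h) fun i =>
    ⟨2 ^ S.s i, (levelIndex_eq S.two_pow_s_strictMono le_rfl
      (S.two_pow_s_strictMono (Nat.lt_succ_self i))).ge⟩

theorem tendsto_coeff : Tendsto S.coeff atTop (𝓝 0) := by
  have := (S.tendsto_C.comp S.tendsto_step).add (tendsto_pow_atTop_nhds_zero_of_lt_one
    (by norm_num : (0 : ℝ) ≤ 1 / 2) (by norm_num))
  rw [add_zero] at this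
  exact this

theorem sum_block_half_pow_le (i : ℕ) : ∑ k ∈ S.block i, (1 / 2 : ℝ) ^ k ≤ 2 * (1 / 2) ^ i := by
  have h1 : i ≤ 2 ^ S.s i :=
    ((Nat.le_add_left _ _).trans (S.le_s i)).trans Nat.lt_two_pow_self.le
  calc ∑ k ∈ S.block i, (1 / 2 : ℝ) ^ k ≤ (1 / 2) ^ (2 ^ S.s i) / (1 - 1 / 2) := by
        refine geom_sum_Ico_le_of_lt_one (by norm_num) (by norm_num)
    _ = 2 * (1 / 2) ^ (2 ^ S.s i) := by ring
    _ ≤ 2 * (1 / 2) ^ i := by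
        have := pow_le_pow_of_le_one (by norm_num : (0 : ℝ) ≤ 1 / 2) (by norm_num) h1
        linarith

theorem measurableSet_exc (i : ℕ) : MeasurableSet (S.exc i) :=
  (measurableSet_radOnes _ _).union (measurableSet_radOnes _ _)

theorem measurable_weight : Measurable S.weight := by
  unfold weight
  refine (Measurable.const_add (Measurable.ennreal_toReal ?_) 1).inv
  exact Measurable.tsum fun i => measurable_const.indicator (S.measurableSet_exc i)

theorem weight_pos (x : ℝ) : 0 < S.weight x := by unfold weight; positivity

theorem weight_le_one (x : ℝ) : S.weight x ≤ 1 :=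
  inv_le_one_of_one_le₀ (le_add_of_nonneg_right ENNReal.toReal_nonneg)

theorem isWeight_weight : IsWeight S.weight :=
  ⟨S.measurable_weight, fun x _ => S.weight_pos x, fun x _ => S.weight_le_one x⟩

theorem weight_eq_one {x : ℝ} (h : ∀ i, x ∉ S.exc i) : S.weight x = 1 := by
  have : ∀ i, (S.exc i).indicator (fun _ => ENNReal.ofReal (S.penalty i)) x = 0 := fun i =>
    indicator_of_notMem (h i) _
  simp [weight, this]

theorem measure_radOnes (s l : ℕ) : unitMeasure (radOnes s l) = ENNReal.ofReal ((1 / 2) ^ l) := by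
  rw [← measureReal_radOnes s l, measureReal_def, ENNReal.ofReal_toReal (measure_ne_top _ _)]

/-- Borel–Cantelli, applied to the two kinds of sets separately. The ranks repeat throughout a
phase, so for `radOnes 0 K` it is applied over `K` and then composed with `rank → ∞`. -/
theorem ae_eventually_notMem_exc : ∀ᵐ x ∂unitMeasure, ∀ᶠ i in atTop, x ∉ S.exc i := by
  have h1 : ∑' i, unitMeasure (radOnes (S.s i) (S.l i)) ≠ ⊤ := by
    simp only [measure_radOnes]
    exact S.l_summable.tsum_ofReal_ne_top
  have h2 : ∑' K, unitMeasure (radOnes 0 K) ≠ ⊤ := by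
    simp only [measure_radOnes]
    exact (summable_geometric_of_lt_one (by norm_num) (by norm_num)).tsum_ofReal_ne_top
  have hr : Tendsto S.rank atTop atTop := tendsto_atTop_mono (fun i => Nat.le_add_left _ _) S.tendsto_phase
  filter_upwards [ae_eventually_notMem h1, ae_eventually_notMem h2] with x hx1 hx2
  filter_upwards [hx1, hr.eventually hx2] with i h3 h4
  exact fun h => h.elim h4 h3

/-- Where the sum of penalties is finite, it dominates each penalty active at the point. Where it is
infinite, `toReal` gives 0 and the weight is 1; this happens only on a null set. -/
theorem ae_penalty_mul_weight_le :
    ∀ᵐ x ∂unitMeasure, ∀ i, x ∈ S.exc i → S.penalty i * S.weight x ≤ 1 := by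
  filter_upwards [S.ae_eventually_notMem_exc] with x hx i hi
  set f : ℕ → ENNReal := fun i => (S.exc i).indicator (fun _ => ENNReal.ofReal (S.penalty i)) x
  obtain ⟨N, hN⟩ := eventually_atTop.1 hx
  have hfin : ∑' i, f i ≠ ⊤ := by
    rw [tsum_eq_sum (s := Finset.range N) fun j hj =>
      indicator_of_notMem (hN j (by simpa using hj)) _]
    refine ENNReal.sum_ne_top.2 fun j _ => ?_
    by_cases h : x ∈ S.exc j <;> simp [h]
  have hle : S.penalty i ≤ (∑' i, f i).toReal := by
    rw [← ENNReal.ofReal_le_iff_le_toReal hfin]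
    calc ENNReal.ofReal (S.penalty i) = f i := by simp [f, hi]
      _ ≤ _ := ENNReal.le_tsum i
  rw [weight, ← div_eq_mul_inv, div_le_one (by positivity)]
  exact hle.trans (le_add_of_nonneg_left zero_le_one)

theorem lt_volume_weight_eq_one {δ : ℝ} (hδ : δ ≤ 1)
    (hS : (1 / 2) ^ S.κ + ∑' i, (1 / 2 : ℝ) ^ S.l i < δ) :
    ENNReal.ofReal (1 - δ) < volume {x : ℝ | x ∈ Icc (0 : ℝ) 1 ∧ S.weight x = 1} := by
  set E : Set ℝ := ⋃ i, S.exc i with hE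
  have hEm : MeasurableSet E := MeasurableSet.iUnion S.measurableSet_exc
  -- All ranks are at least `κ`, so the sets `radOnes 0 (rank i)` are nested in `radOnes 0 κ` and
  -- cost `2^-κ` once, not once per step.
  have hsub : E ⊆ radOnes 0 S.κ ∪ ⋃ i, radOnes (S.s i) (S.l i) := by
    refine iUnion_subset fun i => union_subset_union (fun x hx t ht => hx t ?_)
      (subset_iUnion (fun i => radOnes (S.s i) (S.l i)) i)
    exact ht.trans_le (Nat.le_add_right _ _)
  have hEle : unitMeasure E ≤ ENNReal.ofReal ((1 / 2) ^ S.κ + ∑' i, (1 / 2 : ℝ) ^ S.l i) := by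
    refine (measure_mono hsub).trans ((measure_union_le _ _).trans ?_)
    rw [ENNReal.ofReal_add (by positivity) (tsum_nonneg fun i => by positivity),
      ENNReal.ofReal_tsum_of_nonneg (fun i => by positivity) S.l_summable, measure_radOnes]
    gcongr
    refine (measure_iUnion_le _).trans (le_of_eq ?_)
    simp only [measure_radOnes]
  have hreal : unitMeasure.real E < δ := by
    refine lt_of_le_of_lt ?_ hS
    rw [measureReal_def]
    exact ENNReal.toReal_le_of_le_ofReal
      (add_nonneg (by positivity) (tsum_nonneg fun i => by positivity)) hEle
  have hc : unitMeasure.real Eᶜ = 1 - unitMeasure.real E := probReal_compl_eq_one_sub hEm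
  have hmono : unitMeasure Eᶜ ≤ volume {x : ℝ | x ∈ Icc (0 : ℝ) 1 ∧ S.weight x = 1} := by
    rw [Measure.restrict_apply hEm.compl]
    refine measure_mono fun x hx => ⟨hx.2, S.weight_eq_one fun i hi => hx.1 ?_⟩
    exact mem_iUnion.2 ⟨i, hi⟩
  refine lt_of_lt_of_le ?_ hmono
  rw [← ENNReal.ofReal_toReal (measure_ne_top unitMeasure Eᶜ), ← measureReal_def, hc]
  exact (ENNReal.ofReal_lt_ofReal_iff (by linarith)).2 (by linarith)

end WalshScheme

/-! ### Triangle inequalities in mean and greedy exhaustion -/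

theorem integral_abs_add_le {α : Type*} [MeasurableSpace α] {m : Measure α} {f g : α → ℝ}
    (hf : Integrable f m) (hg : Integrable g m) :
    ∫ x, |f x + g x| ∂m ≤ ∫ x, |f x| ∂m + ∫ x, |g x| ∂m := by
  rw [← integral_add hf.abs hg.abs]
  exact integral_mono (hf.add hg).abs (hf.abs.add hg.abs) fun x => abs_add_le _ _

theorem integral_abs_sum_le {α ι : Type*} [MeasurableSpace α] {m : Measure α} {f : ι → α → ℝ}
    (F : Finset ι) (hf : ∀ i ∈ F, Integrable (f i) m) :
    ∫ x, |∑ i ∈ F, f i x| ∂m ≤ ∑ i ∈ F, ∫ x, |f i x| ∂m := by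
  rw [← integral_finsetSum F fun i hi => (hf i hi).abs]
  exact integral_mono (integrable_finsetSum F hf).abs
    (integrable_finsetSum F fun i hi => (hf i hi).abs) fun x => Finset.abs_sum_le_sum_abs _ _

/-- A greedy exhaustion: a finitely supported function of small total mass is, up to `H`, a signed
sum of point masses of prescribed sizes, with partial sums dominated by the function. -/
theorem exists_greedy_masses {P : Type*} [Fintype P] [DecidableEq P] [Nonempty P] {H : ℝ} (N : ℕ)
    {η : ℕ → ℝ} (hη0 : ∀ i < N, 0 ≤ η i) (hηH : ∀ i < N, η i ≤ H) (hH : 0 ≤ H) {v : P → ℝ}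
    (hv : ∑ p, |v p| ≤ ∑ i ∈ Finset.range N, η i) :
    ∃ (b : ℕ → P) (τ : ℕ → ℝ), (∀ i, τ i = 0 ∨ τ i = 1 ∨ τ i = -1) ∧
      (∀ n ≤ N, ∀ p, |∑ i ∈ Finset.range n, τ i * (if p = b i then η i else 0)| ≤ |v p|) ∧
      ∀ p, |v p - ∑ i ∈ Finset.range N, τ i * (if p = b i then η i else 0)| ≤ H := by
  induction N generalizing η v with
  | zero =>
    have hv0 : ∀ p, |v p| ≤ 0 := fun p => by
      rw [Finset.sum_range_zero] at hv
      exact (Finset.single_le_sum (f := fun p => |v p|) (fun p _ => abs_nonneg _)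
        (Finset.mem_univ p)).trans hv
    refine ⟨fun _ => Classical.arbitrary P, fun _ => 0, fun _ => Or.inl rfl, fun n _ p => by simp,
      fun p => by simpa using (hv0 p).trans hH⟩
  | succ N ih =>
    -- If some point still carries mass at least `η 0`, removing `η 0` there lowers the total by
    -- exactly `η 0` and never overshoots zero. Otherwise every remaining value is below `η 0 ≤ H`,
    -- and the process stops with all later `τ` equal to 0.
    by_cases hex : ∃ p, η 0 ≤ |v p|
    · obtain ⟨p₀, hp₀⟩ := hex
      have hη00 := hη0 0 (Nat.succ_pos N)
      obtain ⟨σ, hσ, hσv⟩ : ∃ σ : ℝ, (σ = 1 ∨ σ = -1) ∧ σ * |v p₀| = v p₀ := by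
        rcases le_total 0 (v p₀) with h | h
        · exact ⟨1, Or.inl rfl, by rw [abs_of_nonneg h, one_mul]⟩
        · exact ⟨-1, Or.inr rfl, by rw [abs_of_nonpos h]; ring⟩
      have hσabs : |σ| = 1 := by rcases hσ with h | h <;> simp [h]
      set v' : P → ℝ := fun p => v p - σ * (if p = p₀ then η 0 else 0) with hv'
      have hv'abs : ∀ p, |v' p| = |v p| - if p = p₀ then η 0 else 0 := by
        intro p
        simp only [hv']
        split_ifs with h
        · subst h
          nth_rewrite 1 [← hσv]
          rw [← mul_sub, abs_mul, hσabs, one_mul, abs_of_nonneg (by linarith)]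
        · simp
      have hsum : ∑ p, |v' p| ≤ ∑ i ∈ Finset.range N, η (i + 1) := by
        simp only [hv'abs, Finset.sum_sub_distrib]
        rw [Finset.sum_range_succ'] at hv
        simp only [Finset.sum_ite_eq', Finset.mem_univ, if_true]
        linarith
      obtain ⟨b, τ, h1, h2, h3⟩ := ih (η := fun i => η (i + 1))
        (fun i hi => hη0 _ (by omega)) (fun i hi => hηH _ (by omega)) hsum
      refine ⟨fun n => Nat.casesOn n p₀ b, fun n => Nat.casesOn n σ τ, fun i => ?_, fun n hn p => ?_,
        fun p => ?_⟩
      · cases i with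
        | zero => exact Or.inr hσ
        | succ i => exact h1 i
      · cases n with
        | zero => simp
        | succ n =>
          rw [Finset.sum_range_succ']
          refine (abs_add_le _ _).trans ?_
          have := h2 n (by omega) p
          rw [hv'abs p] at this
          have h4 : |σ * (if p = p₀ then η 0 else 0)| = if p = p₀ then η 0 else 0 := by
            rw [abs_mul, hσabs, one_mul, abs_of_nonneg]
            split_ifs <;> simp [hη00]
          have h5 := add_le_add this h4.le
          rw [sub_add_cancel] at h5
          exact h5
      · rw [Finset.sum_range_succ', add_comm, ← sub_sub]
        exact h3 p
    · push Not at hex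
      refine ⟨fun _ => Classical.arbitrary P, fun _ => 0, fun _ => Or.inl rfl, fun n _ p => by simp,
        fun p => ?_⟩
      simpa using (hex p).le.trans (hηH 0 (Nat.succ_pos N))

/-! ### Steps and phases in the weighted space -/

namespace WalshScheme

variable (S : WalshScheme)

/-- The weighted measure on the unit interval. -/
noncomputable def wmeas : Measure ℝ :=
  unitMeasure.withDensity fun x => ENNReal.ofReal (S.weight x)

theorem wmeas_le : S.wmeas ≤ unitMeasure := by
  calc S.wmeas ≤ unitMeasure.withDensity 1 :=
        withDensity_mono (Eventually.of_forall fun x =>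
          ENNReal.ofReal_le_one.2 (S.weight_le_one x))
    _ = unitMeasure := withDensity_one

instance isFiniteMeasure_wmeas : IsFiniteMeasure S.wmeas := isFiniteMeasure_of_le _ S.wmeas_le

theorem wmeas_ac : S.wmeas ≪ unitMeasure := withDensity_absolutelyContinuous _ _

theorem integral_wmeas (h : ℝ → ℝ) :
    ∫ x, h x ∂S.wmeas = ∫ x, h x * S.weight x ∂unitMeasure := by
  rw [wmeas, integral_withDensity_eq_integral_toReal_smul S.measurable_weight.ennreal_ofReal
    (Eventually.of_forall fun _ => ENNReal.ofReal_lt_top)]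
  refine integral_congr_ae (Eventually.of_forall fun x => ?_)
  simp only [smul_eq_mul, ENNReal.toReal_ofReal (S.weight_pos x).le, mul_comm]

theorem integrable_wmeas_iff {h : ℝ → ℝ} :
    Integrable h S.wmeas ↔ Integrable (fun x => h x * S.weight x) unitMeasure := by
  rw [wmeas, integrable_withDensity_iff_integrable_smul' S.measurable_weight.ennreal_ofReal
    (Eventually.of_forall fun _ => ENNReal.ofReal_lt_top)]
  simp only [smul_eq_mul, ENNReal.toReal_ofReal (S.weight_pos _).le, mul_comm]

theorem integral_abs_wmeas_le {h : ℝ → ℝ} (hh : Integrable h unitMeasure) :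
    ∫ x, |h x| ∂S.wmeas ≤ ∫ x, |h x| ∂unitMeasure :=
  integral_mono_measure S.wmeas_le (Eventually.of_forall fun _ => abs_nonneg _) hh.abs

theorem integrable_cell (m : Measure ℝ) [IsFiniteMeasure m] {K : ℕ} (v : (Fin K → Bool) → ℝ) :
    Integrable (fun x => v (dyadicCell K x)) m := by
  refine ((measurable_of_finite v).comp (measurable_dyadicCell K)).integrable_of_abs_le
    (B := ∑ b, |v b|) fun x => ?_
  exact Finset.single_le_sum (f := fun b => |v b|) (fun b _ => abs_nonneg _) (Finset.mem_univ _)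

theorem integrable_sum_coeff (m : Measure ℝ) [IsFiniteMeasure m] (F : Finset ℕ) (ψ : ℕ → ℝ) :
    Integrable (fun x => ∑ k ∈ F, ψ k * S.coeff k * walsh k x) m :=
  integrable_sum_walsh m F fun k => ψ k * S.coeff k

theorem sum_coeff_eq {i : ℕ} {F : Finset ℕ} (hF : F ⊆ S.block i) (ψ : ℕ → ℝ) (x : ℝ) :
    ∑ k ∈ F, ψ k * S.coeff k * walsh k x =
      S.C i * ∑ k ∈ F, ψ k * walsh k x + ∑ k ∈ F, ψ k * (1 / 2) ^ k * walsh k x := by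
  rw [Finset.mul_sum, ← Finset.sum_add_distrib]
  refine Finset.sum_congr rfl fun k hk => ?_
  rw [S.coeff_eq (hF hk)]
  ring

theorem abs_sum_half_pow_le {i : ℕ} {F : Finset ℕ} (hF : F ⊆ S.block i) {ψ : ℕ → ℝ}
    (hψ : ∀ k, ψ k = 1 ∨ ψ k = -1) (x : ℝ) :
    |∑ k ∈ F, ψ k * (1 / 2) ^ k * walsh k x| ≤ 2 * (1 / 2) ^ i := by
  refine (Finset.abs_sum_le_sum_abs _ _).trans (le_trans ?_ (S.sum_block_half_pow_le i))
  refine (Finset.sum_le_sum fun k _ => ?_).trans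
    (Finset.sum_le_sum_of_subset_of_nonneg hF fun k _ _ => by positivity)
  rw [abs_mul, abs_mul, abs_of_nonneg (by positivity : (0 : ℝ) ≤ (1 / 2) ^ k)]
  have : |ψ k| = 1 := by rcases hψ k with h | h <;> simp [h]
  rw [this, one_mul]
  exact mul_le_of_le_one_right (by positivity) (abs_walsh_le_one k x)

/-- Partial sums inside a step are small if those of the plain signs are controlled. -/
theorem integral_abs_partial_step_le {i m : ℕ} {ψ : ℕ → ℝ} (hψ : ∀ k, ψ k = 1 ∨ ψ k = -1)
    (hm : m ≤ 2 ^ S.s (i + 1))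
    (h : ∫ x, |∑ k ∈ Finset.Ico (2 ^ S.s i) m, ψ k * walsh k x| ∂unitMeasure ≤
      (S.s i + S.l i : ℕ) + 2 + 2 ^ S.rank i * (2 * S.l i + 6)) :
    ∫ x, |∑ k ∈ Finset.Ico (2 ^ S.s i) m, ψ k * S.coeff k * walsh k x| ∂unitMeasure ≤
      13 * (1 / 2) ^ S.phase i := by
  have hF : Finset.Ico (2 ^ S.s i) m ⊆ S.block i := Finset.Ico_subset_Ico_right hm
  have i1 := (integrable_sum_walsh unitMeasure (Finset.Ico (2 ^ S.s i) m) ψ).const_mul (S.C i)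
  have i2 := integrable_sum_walsh unitMeasure (Finset.Ico (2 ^ S.s i) m)
    fun k => ψ k * (1 / 2) ^ k
  simp only [S.sum_coeff_eq hF]
  calc _ ≤ _ := integral_abs_add_le i1 i2
    _ ≤ 11 * (1 / 2) ^ S.phase i + 2 * (1 / 2) ^ i := by
        refine add_le_add ?_ ?_
        · simp only [abs_mul, abs_of_pos (S.C_pos i)]
          rw [integral_const_mul]
          exact (mul_le_mul_of_nonneg_left h (S.C_pos i).le).trans (S.C_mul_le i)
        · refine (integral_mono i2.abs (integrable_const (2 * (1 / 2) ^ i : ℝ))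
            fun x => S.abs_sum_half_pow_le hF hψ x).trans (by simp)
    _ ≤ _ := by
        have := pow_le_pow_of_le_one (by norm_num : (0 : ℝ) ≤ 1 / 2) (by norm_num) (S.phase_le i)
        linarith

theorem exists_step {i K : ℕ} (hK : S.rank i = K) (b : Fin K → Bool) {τ : ℝ}
    (hτ : τ = 0 ∨ τ = 1 ∨ τ = -1) :
    ∃ ψ : ℕ → ℝ, (∀ k, ψ k = 1 ∨ ψ k = -1) ∧
      ∫ x, |∑ k ∈ S.block i, ψ k * S.coeff k * walsh k x -
        τ * (if dyadicCell K x = b then S.C i * 2 ^ K else 0)| ∂S.wmeas ≤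
          3 * (1 / 2) ^ i ∧
      ∀ m, 2 ^ S.s i ≤ m → m ≤ 2 ^ S.s (i + 1) →
        ∫ x, |∑ k ∈ Finset.Ico (2 ^ S.s i) m, ψ k * S.coeff k * walsh k x| ∂S.wmeas ≤
          13 * (1 / 2) ^ S.phase i := by
  subst hK
  obtain ⟨ψ, h1, h2, h3⟩ := exists_step_signs (l := S.l i) (S.rank_le i) b hτ
  refine ⟨ψ, h1, ?_, fun m hm1 hm2 => ?_⟩
  · have hblock : S.block i = Finset.Ico (2 ^ S.s i) (2 ^ (S.s i + S.l i)) := by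
      rw [block, S.s_succ]
    set a : ℝ → ℝ := fun x => τ * (if dyadicCell (S.rank i) x = b then S.C i * 2 ^ S.rank i else 0) with ha
    have hai : Integrable a S.wmeas := by
      have := integrable_cell S.wmeas fun c : Fin (S.rank i) → Bool =>
        τ * (if c = b then S.C i * 2 ^ S.rank i else 0)
      exact this
    have haB : ∀ x, |a x| ≤ S.C i * 2 ^ S.rank i := by
      intro x
      have hpos : 0 ≤ S.C i * 2 ^ S.rank i := mul_nonneg (S.C_pos i).le (by positivity)
      have hτ1 : |τ| ≤ 1 := by rcases hτ with h | h | h <;> simp [h]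
      simp only [ha]
      rw [abs_mul]
      refine (mul_le_of_le_one_left (abs_nonneg _) hτ1).trans ?_
      split_ifs
      · rw [abs_of_nonneg hpos]
      · simpa using hpos
    have hint : Integrable (fun x => |∑ k ∈ S.block i, ψ k * S.coeff k * walsh k x - a x|)
        S.wmeas := ((S.integrable_sum_coeff S.wmeas (S.block i) ψ).sub hai).abs
    rw [integral_wmeas]
    have hae : ∀ᵐ x ∂unitMeasure,
        |∑ k ∈ S.block i, ψ k * S.coeff k * walsh k x - a x| * S.weight x ≤ 3 * (1 / 2) ^ i := by
      filter_upwards [S.ae_penalty_mul_weight_le, ae_radSeq_eq_one_or unitMeasure] with x hx hr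
      have hw := S.weight_pos x
      have hp : (0 : ℝ) < (1 / 2) ^ i := by positivity
      -- On the exceptional set the crude bound by the sum of moduli is, up to `2^i`, the penalty,
      -- so the weight brings it below `2^-i`. Elsewhere the part with coefficient `C i` is exact
      -- and only the terms `2^-k` remain.
      by_cases hxe : x ∈ S.exc i
      · have h4 := hx i hxe
        have h5 : |∑ k ∈ S.block i, ψ k * S.coeff k * walsh k x - a x| ≤
            ∑ k ∈ S.block i, S.coeff k + S.C i * 2 ^ S.rank i := by
          refine (abs_sub _ _).trans (add_le_add ?_ (haB x))
          refine (Finset.abs_sum_le_sum_abs _ _).trans (Finset.sum_le_sum fun k _ => ?_)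
          have : |ψ k| = 1 := by rcases h1 k with h | h <;> simp [h]
          rw [abs_mul, abs_mul, this, one_mul, abs_of_pos (S.coeff_pos k)]
          exact mul_le_of_le_one_right (S.coeff_pos k).le (abs_walsh_le_one k x)
        have h6 : (∑ k ∈ S.block i, S.coeff k + S.C i * 2 ^ S.rank i) * S.weight x ≤ (1 / 2) ^ i := by
          rw [penalty, mul_assoc] at h4
          rw [one_div_pow, le_div_iff₀ (by positivity), mul_comm]
          exact h4
        have h7 := mul_le_mul_of_nonneg_right h5 hw.le
        linarith
      · rw [S.sum_coeff_eq (Finset.Subset.refl _), hblock, h2 x hr hxe]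
        have h4 : S.C i * (τ * if dyadicCell (S.rank i) x = b then 2 ^ S.rank i else 0) = a x := by
          simp only [ha]
          split_ifs <;> ring
        rw [h4, add_sub_cancel_left, ← hblock]
        have h5 := S.abs_sum_half_pow_le (Finset.Subset.refl (S.block i)) h1 x
        have h6 := mul_le_of_le_one_right (abs_nonneg
          (∑ k ∈ S.block i, ψ k * (1 / 2) ^ k * walsh k x)) (S.weight_le_one x)
        linarith
    refine (integral_mono_ae ((S.integrable_wmeas_iff).1 hint)
      (integrable_const (3 * (1 / 2) ^ i : ℝ)) hae).trans ?_
    simp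
  · refine (S.integral_abs_wmeas_le (S.integrable_sum_coeff _ _ ψ)).trans
      (S.integral_abs_partial_step_le h1 hm2 ?_)
    refine h3 m hm1 ?_
    rwa [← S.s_succ]

end WalshScheme

namespace WalshScheme

variable (S : WalshScheme)

/-- The first frequency of a phase. -/
def start (n : ℕ) : ℕ := 2 ^ S.s (S.I n)

theorem start_strictMono : StrictMono S.start :=
  fun _ _ h => S.two_pow_s_strictMono (S.I_strictMono h)

theorem sum_Ico_eq_sum_block (f : ℕ → ℝ) (a q : ℕ) :
    ∑ k ∈ Finset.Ico (2 ^ S.s a) (2 ^ S.s (a + q)), f k =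
      ∑ j ∈ Finset.range q, ∑ k ∈ S.block (a + j), f k := by
  induction q with
  | zero => simp
  | succ q ih =>
    rw [Finset.sum_range_succ, ← ih, block, ← add_assoc, Finset.sum_Ico_consecutive]
    · exact S.two_pow_s_strictMono.monotone (Nat.le_add_right a q)
    · exact S.two_pow_s_strictMono.monotone (Nat.le_succ _)

theorem measureReal_wmeas_le : S.wmeas.real univ ≤ 1 := by
  rw [measureReal_def]
  refine ENNReal.toReal_le_of_le_ofReal zero_le_one ?_
  rw [ENNReal.ofReal_one]
  exact (S.wmeas_le univ).trans prob_le_one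

theorem integral_le_of_abs_le {h : ℝ → ℝ} (hh : Integrable h S.wmeas) {B : ℝ} (hB : 0 ≤ B)
    (hle : ∀ x, |h x| ≤ B) : ∫ x, |h x| ∂S.wmeas ≤ B := by
  refine (integral_mono hh.abs (integrable_const B) hle).trans ?_
  rw [integral_const, smul_eq_mul]
  exact mul_le_of_le_one_left hB S.measureReal_wmeas_le

/-- In a phase one may choose signs so that the sum over the phase is close to any prescribed
function which is constant on dyadic cells and not too large, with controlled partial sums. -/
theorem exists_phase {n K : ℕ} (hK : S.κ + n = K) {v : (Fin K → Bool) → ℝ}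
    (hv : ∑ b, |v b| ≤ n * 2 ^ K) :
    ∃ ψ : ℕ → ℝ, (∀ k, ψ k = 1 ∨ ψ k = -1) ∧
      ∫ x, |∑ k ∈ Finset.Ico (S.start n) (S.start (n + 1)), ψ k * S.coeff k * walsh k x -
        v (dyadicCell K x)| ∂S.wmeas ≤ 8 * (1 / 2) ^ n ∧
      ∀ m, S.start n ≤ m → m < S.start (n + 1) →
        ∫ x, |∑ k ∈ Finset.Ico (S.start n) m, ψ k * S.coeff k * walsh k x| ∂S.wmeas ≤
          ∫ x, |v (dyadicCell K x)| ∂S.wmeas + 19 * (1 / 2) ^ n := by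
  set a := S.I n with ha
  obtain ⟨N, hN'⟩ := Nat.exists_eq_add_of_le (S.I_strictMono (Nat.lt_succ_self n)).le
  have hN : S.I (n + 1) = a + N := hN'
  have hna : n ≤ a := S.I_strictMono.le_apply
  have hphase : ∀ j < N, S.phase (a + j) = n := fun j hj =>
    S.phase_eq (Nat.le_add_right _ _) (by rw [hN]; omega)
  set η : ℕ → ℝ := fun j => S.C (a + j) * 2 ^ K with hη
  have hηsum : ∑ b, |v b| ≤ ∑ j ∈ Finset.range N, η j := by
    refine hv.trans ?_
    have := S.C_sum n
    rw [hN, Finset.sum_Ico_eq_sum_range, ← ha, Nat.add_sub_cancel_left] at this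
    simp only [hη, ← Finset.sum_mul]
    gcongr
  have hH : (0 : ℝ) ≤ 2 * (1 / 2) ^ n := by positivity
  -- One mass per step: step `a + j` can place the height `C (a + j) * 2^K` on a cell. Smallness of
  -- this height bounds the final uniform error.
  obtain ⟨b, τ, hτ, hpart, hfin⟩ := exists_greedy_masses (H := 2 * (1 / 2) ^ n) N (η := η)
    (fun j _ => mul_nonneg (S.C_pos _).le (by positivity)) (fun j hj => by
      have := S.C_mul_two_pow_rank_le (a + j)
      rwa [rank, hphase j hj, hK] at this) hH hηsum
  have hstep : ∀ j, ∃ ψ : ℕ → ℝ, (∀ k, ψ k = 1 ∨ ψ k = -1) ∧ (j < N →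
      ∫ x, |∑ k ∈ S.block (a + j), ψ k * S.coeff k * walsh k x -
        τ j * (if dyadicCell K x = b j then η j else 0)| ∂S.wmeas ≤ 3 * (1 / 2) ^ (a + j) ∧
      ∀ m, 2 ^ S.s (a + j) ≤ m → m ≤ 2 ^ S.s (a + j + 1) →
        ∫ x, |∑ k ∈ Finset.Ico (2 ^ S.s (a + j)) m, ψ k * S.coeff k * walsh k x| ∂S.wmeas ≤
          13 * (1 / 2) ^ n) := by
    intro j
    by_cases hj : j < N
    · obtain ⟨ψ, h1, h2, h3⟩ := S.exists_step (i := a + j) (K := K)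
        (by rw [rank, hphase j hj, hK]) (b j) (hτ j)
      rw [hphase j hj] at h3
      exact ⟨ψ, h1, fun _ => ⟨h2, h3⟩⟩
    · exact ⟨fun _ => 1, fun _ => Or.inl rfl, fun h => absurd h hj⟩
  choose ψ hψ1 hψ2 using hstep
  set Ψ : ℕ → ℝ := fun k => ψ (S.step k - a) k with hΨ
  have hΨ_eq : ∀ j k, k ∈ S.block (a + j) → Ψ k = ψ j k := fun j k hk => by
    simp only [hΨ]; rw [S.step_eq hk, Nat.add_sub_cancel_left]
  have hblock : ∀ j x, ∑ k ∈ S.block (a + j), Ψ k * S.coeff k * walsh k x =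
      ∑ k ∈ S.block (a + j), ψ j k * S.coeff k * walsh k x := fun j x =>
    Finset.sum_congr rfl fun k hk => by rw [hΨ_eq j k hk]
  set A : ℕ → ℝ → ℝ := fun j x => τ j * (if dyadicCell K x = b j then η j else 0) with hA
  have hAi : ∀ j, Integrable (A j) S.wmeas := fun j =>
    integrable_cell S.wmeas fun c : Fin K → Bool => τ j * (if c = b j then η j else 0)
  have hAsum : ∀ q, Integrable (fun x => ∑ j ∈ Finset.range q, A j x) S.wmeas := fun q =>
    integrable_finsetSum _ fun j _ => hAi j
  have herr : ∀ q ≤ N, ∫ x, |∑ k ∈ Finset.Ico (2 ^ S.s a) (2 ^ S.s (a + q)),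
      Ψ k * S.coeff k * walsh k x - ∑ j ∈ Finset.range q, A j x| ∂S.wmeas ≤ 6 * (1 / 2) ^ n := by
    intro q hq
    simp only [S.sum_Ico_eq_sum_block, ← Finset.sum_sub_distrib, hblock]
    refine (integral_abs_sum_le _ fun j _ => (S.integrable_sum_coeff _ _ _).sub (hAi j)).trans ?_
    have h1 : ∀ j ∈ Finset.range q, ∫ x, |∑ k ∈ S.block (a + j), ψ j k * S.coeff k * walsh k x -
        A j x| ∂S.wmeas ≤ 3 * (1 / 2) ^ n * (1 / 2) ^ j := fun j hj => by
      refine ((hψ2 j ((Finset.mem_range.1 hj).trans_le hq)).1).trans ?_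
      rw [pow_add, mul_assoc]
      have := pow_le_pow_of_le_one (by norm_num : (0 : ℝ) ≤ 1 / 2) (by norm_num) hna
      gcongr
    refine (Finset.sum_le_sum h1).trans ?_
    rw [← Finset.mul_sum]
    have h2 : ∑ j ∈ Finset.range q, (1 / 2 : ℝ) ^ j ≤ 2 := sum_geometric_two_le q
    have h3 : (0 : ℝ) < (1 / 2) ^ n := by positivity
    nlinarith
  have hvi := integrable_cell S.wmeas v
  refine ⟨Ψ, fun k => hψ1 _ _, ?_, fun m hm1 hm2 => ?_⟩
  · have hst : S.start (n + 1) = 2 ^ S.s (a + N) := by rw [start, hN]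
    have hst0 : S.start n = 2 ^ S.s a := rfl
    rw [hst, hst0]
    have e1 := herr N le_rfl
    have hdiff := (hAsum N).sub hvi
    have e2 : ∫ x, |∑ j ∈ Finset.range N, A j x - v (dyadicCell K x)| ∂S.wmeas ≤
        2 * (1 / 2) ^ n := by
      refine S.integral_le_of_abs_le hdiff hH fun x => ?_
      rw [Pi.sub_apply, abs_sub_comm]
      exact hfin _
    have e3 := integral_abs_add_le ((S.integrable_sum_coeff S.wmeas
      (Finset.Ico (2 ^ S.s a) (2 ^ S.s (a + N))) Ψ).sub (hAsum N)) hdiff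
    simp only [Pi.sub_apply, sub_add_sub_cancel] at e3
    linarith
  -- A partial sum of the phase consists of `q` complete steps, within `6 * 2^-n` of a greedy
  -- partial sum dominated by `|v|`, and one incomplete step of norm at most `13 * 2^-n`; hence the
  -- 19.
  · have hmem : m ∈ S.block (S.step m) := S.mem_block_step (by
      refine le_trans ?_ hm1
      exact S.two_pow_s_strictMono.monotone (Nat.zero_le _))
    obtain ⟨hmem1, hmem2⟩ := Finset.mem_Ico.1 hmem
    have ham : a ≤ S.step m := by
      by_contra h
      have := S.two_pow_s_strictMono.monotone (Nat.succ_le_of_lt (not_le.1 h))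
      exact absurd hm1 (not_le.2 (hmem2.trans_le this))
    obtain ⟨q, hq⟩ := Nat.exists_eq_add_of_le ham
    have hqN : q < N := by
      by_contra h
      have h1 : S.I (n + 1) ≤ S.step m := by omega
      exact absurd hm2 (not_lt.2 ((S.two_pow_s_strictMono.monotone h1).trans hmem1))
    rw [hq] at hmem1 hmem2
    have hst0 : S.start n = 2 ^ S.s a := rfl
    rw [hst0]
    have e1 := herr q hqN.le
    have e2 := (hψ2 q hqN).2 m hmem1 hmem2.le
    have e3 : ∫ x, |∑ j ∈ Finset.range q, A j x| ∂S.wmeas ≤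
        ∫ x, |v (dyadicCell K x)| ∂S.wmeas :=
      integral_mono (hAsum q).abs hvi.abs fun x => hpart q hqN.le _
    have hsub : ∀ x, ∑ k ∈ Finset.Ico (2 ^ S.s (a + q)) m, Ψ k * S.coeff k * walsh k x =
        ∑ k ∈ Finset.Ico (2 ^ S.s (a + q)) m, ψ q k * S.coeff k * walsh k x := fun x =>
      Finset.sum_congr rfl fun k hk => by
        rw [hΨ_eq q k (Finset.Ico_subset_Ico_right hmem2.le hk)]
    simp only [← hsub] at e2
    have e4 := integral_abs_add_le ((S.integrable_sum_coeff S.wmeas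
      (Finset.Ico (2 ^ S.s a) (2 ^ S.s (a + q))) Ψ).sub (hAsum q)) (hAsum q)
    simp only [Pi.sub_apply, sub_add_cancel] at e4
    have e5 := integral_abs_add_le (S.integrable_sum_coeff S.wmeas
      (Finset.Ico (2 ^ S.s a) (2 ^ S.s (a + q))) Ψ) (S.integrable_sum_coeff S.wmeas
      (Finset.Ico (2 ^ S.s (a + q)) m) Ψ)
    simp only [Finset.sum_Ico_consecutive _
      (S.two_pow_s_strictMono.monotone (Nat.le_add_right a q)) hmem1] at e5
    linarith

end WalshScheme

/-! ### Successive corrections and universality -/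

/-- Approximation by successive corrections with summable errors. -/
theorem exists_corrections_tendsto_zero {E : Type*} [SeminormedAddCommGroup E] {V : ℕ → Type*}
    (u T : ∀ n, V n → E) (z : ∀ n, V n) (hz : ∀ n, u n (z n) = 0) {τ : ℕ → ℝ} (hτ : Summable τ)
    (hT : ∀ n v, ‖T n v - u n v‖ ≤ τ n)
    (hu : ∀ x : E, ∀ ε > 0, ∃ n₀, ∀ n ≥ n₀, ∃ v, ‖x - u n v‖ ≤ ε) (f : E) :
    ∃ v : ∀ n, V n, Tendsto (fun n => f - ∑ j ∈ Finset.range n, T j (v j)) atTop (𝓝 0) ∧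
      ∀ n, ‖u n (v n)‖ ≤ 2 * ‖f - ∑ j ∈ Finset.range n, T j (v j)‖ := by
  classical
  -- Correct only when the remainder can be halved, and otherwise do nothing. Either way the ideal
  -- correction does not increase the norm of the remainder.
  let ch : ∀ n, E → V n := fun n x =>
    if h : ∃ v, ‖x - u n v‖ ≤ ‖x‖ / 2 then h.choose else z n
  have hch_le : ∀ n x, ‖x - u n (ch n x)‖ ≤ ‖x‖ := by
    intro n x
    by_cases h : ∃ v, ‖x - u n v‖ ≤ ‖x‖ / 2
    · simp only [ch, dif_pos h]
      exact h.choose_spec.trans (half_le_self (norm_nonneg x))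
    · simp only [ch, dif_neg h, hz, sub_zero, le_refl]
  let r : ℕ → E := fun n => Nat.rec f (fun n x => x - T n (ch n x)) n
  have hr_succ : ∀ n, r (n + 1) = r n - T n (ch n (r n)) := fun n => rfl
  have hr_sum : ∀ n, f - ∑ j ∈ Finset.range n, T j (ch j (r j)) = r n := by
    intro n
    induction n with
    | zero => simp [r]
    | succ n ih => rw [Finset.sum_range_succ, ← sub_sub, ih, hr_succ]
  have hτ0 : ∀ n, 0 ≤ τ n := fun n => (norm_nonneg _).trans (hT n (z n))
  have hstep : ∀ n, ‖r (n + 1)‖ ≤ ‖r n - u n (ch n (r n))‖ + τ n := fun n => by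
    have : r (n + 1) = (r n - u n (ch n (r n))) - (T n (ch n (r n)) - u n (ch n (r n))) := by
      rw [hr_succ]; abel
    rw [this]
    exact (norm_sub_le _ _).trans (add_le_add le_rfl (hT _ _))
  refine ⟨fun n => ch n (r n), ?_, fun n => ?_⟩
  swap
  · rw [hr_sum]
    have h1 := norm_sub_le (r n) (r n - u n (ch n (r n)))
    rw [sub_sub_cancel] at h1
    linarith [hch_le n (r n)]
  simp only [hr_sum]
  -- Up to the summable errors the norms of the remainders decrease, so they converge to some `L`.
  have hanti : Antitone fun n => ‖r n‖ - ∑ j ∈ Finset.range n, τ j := by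
    refine antitone_nat_of_succ_le fun n => ?_
    rw [Finset.sum_range_succ]
    linarith [hstep n, hch_le n (r n)]
  have hbdd : BddBelow (range fun n => ‖r n‖ - ∑ j ∈ Finset.range n, τ j) := by
    refine ⟨-∑' j, τ j, ?_⟩
    rintro _ ⟨n, rfl⟩
    have := hτ.sum_le_tsum (Finset.range n) fun j _ => hτ0 j
    dsimp only
    linarith [norm_nonneg (r n)]
  have hlim := (tendsto_atTop_ciInf hanti hbdd).add hτ.hasSum.tendsto_sum_nat
  simp only [sub_add_cancel] at hlim
  set L := (⨅ n, (‖r n‖ - ∑ j ∈ Finset.range n, τ j)) + ∑' j, τ j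
  have hL0 : 0 ≤ L := ge_of_tendsto' hlim fun n => norm_nonneg _
  rcases hL0.eq_or_lt with hL | hL
  · rw [← hL] at hlim
    exact tendsto_zero_iff_norm_tendsto_zero.2 hlim
  exfalso
  obtain ⟨N₁, hN₁⟩ := eventually_atTop.1 (hlim.eventually
    (Ioo_mem_nhds (show 7 / 8 * L < L by linarith) (show L < 9 / 8 * L by linarith)))
  obtain ⟨N₂, hN₂⟩ := eventually_atTop.1
    (hτ.tendsto_atTop_zero.eventually_lt_const (show 0 < L / 16 by linarith))
  obtain ⟨N₃, hN₃⟩ := eventually_atTop.1 ((tendsto_sum_nat_add τ).eventually_lt_const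
    (show 0 < L / 8 by linarith))
  set N := max N₁ (max N₂ N₃)
  have hN1 : N₁ ≤ N := le_max_left _ _
  have hN2 : N₂ ≤ N := (le_max_left _ _).trans (le_max_right _ _)
  have hN3 : N₃ ≤ N := (le_max_right _ _).trans (le_max_right _ _)
  -- If `L > 0`, a late halving would bring the norm to at most `9L/16 + L/16`, below `7L/8`. So
  -- only zero corrections occur after `N`, and the remainder moves by less than `L/8` in total. But
  -- `r N` itself is eventually approximable within `L/8`, which makes a halving possible: a
  -- contradiction.
  have hno : ∀ n ≥ N, ¬ ∃ v, ‖r n - u n v‖ ≤ ‖r n‖ / 2 := by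
    intro n hn h
    have h1 : ‖r n - u n (ch n (r n))‖ ≤ ‖r n‖ / 2 := by
      simp only [ch, dif_pos h]; exact h.choose_spec
    have h2 := (hN₁ n (hN1.trans hn)).2
    have h3 := (hN₁ (n + 1) ((hN1.trans hn).trans (Nat.le_succ n))).1
    have h4 := hN₂ n (hN2.trans hn)
    have h5 := hstep n
    linarith
  have hdist : ∀ q, ‖r N - r (N + q)‖ ≤ ∑ j ∈ Finset.range q, τ (j + N) := by
    intro q
    induction q with
    | zero => simp
    | succ q ih =>
      have h1 : ch (N + q) (r (N + q)) = z (N + q) := by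
        simp only [ch, dif_neg (hno (N + q) (Nat.le_add_right _ _))]
      have h2 := hT (N + q) (z (N + q))
      rw [hz, sub_zero] at h2
      rw [← add_assoc, hr_succ, h1, Finset.sum_range_succ, add_comm q N, sub_sub_eq_add_sub,
        add_sub_right_comm]
      exact (norm_add_le _ _).trans (add_le_add ih h2)
  obtain ⟨n₀, hn₀⟩ := hu (r N) (L / 8) (by linarith)
  obtain ⟨v, hv⟩ := hn₀ (N + n₀) (Nat.le_add_left _ _)
  refine hno (N + n₀) (Nat.le_add_right _ _) ⟨v, ?_⟩
  have h1 := hdist n₀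
  have h2 := ((summable_nat_add_iff N).2 hτ).sum_le_tsum (Finset.range n₀) fun j _ => hτ0 _
  have h3 := hN₃ N hN3
  have h4 := (hN₁ (N + n₀) (hN1.trans (Nat.le_add_right _ _))).1
  have h5 : ‖r (N + n₀) - u (N + n₀) v‖ ≤
      ‖r N - r (N + n₀)‖ + ‖r N - u (N + n₀) v‖ := by
    rw [norm_sub_rev (r N)]
    exact norm_sub_le_norm_sub_add_norm_sub _ _ _
  linarith

namespace WalshScheme

variable (S : WalshScheme)

/-- The set of admissible cell functions for a phase. -/
abbrev Admissible (n : ℕ) : Type :=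
  {v : (Fin (S.κ + n) → Bool) → ℝ // ∑ b, |v b| ≤ n * 2 ^ (S.κ + n)}

/-- Every function integrable for the weighted measure is the sum of a series with the prescribed
moduli of coefficients. -/
theorem exists_signs_tendsto {f : ℝ → ℝ} (hf : Integrable f S.wmeas) :
    ∃ ε : ℕ → ℝ, (∀ k, ε k = 1 ∨ ε k = -1) ∧
      Tendsto (fun m => ∫ x, |∑ k ∈ Finset.range m, ε k * S.coeff k * walsh k x - f x| ∂S.wmeas)
        atTop (𝓝 0) := by
  choose ψ hψ1 hψ2 hψ3 using fun (n : ℕ) (v : S.Admissible n) => S.exists_phase rfl v.2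
  have hint : ∀ F (ψ : ℕ → ℝ), Integrable (fun x => ∑ k ∈ F, ψ k * S.coeff k * walsh k x) S.wmeas :=
    S.integrable_sum_coeff S.wmeas
  have hcell : ∀ n (v : S.Admissible n), Integrable (fun x => v.1 (dyadicCell (S.κ + n) x)) S.wmeas :=
    fun n v => integrable_cell S.wmeas v.1
  let T : ∀ n, S.Admissible n → (ℝ →₁[S.wmeas] ℝ) := fun n v =>
    (hint (Finset.Ico (S.start n) (S.start (n + 1))) (ψ n v)).toL1 _
  let u : ∀ n, S.Admissible n → (ℝ →₁[S.wmeas] ℝ) := fun n v => (hcell n v).toL1 _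
  let z : ∀ n, S.Admissible n := fun n => ⟨0, by simp⟩
  -- Frequencies below the first phase receive the sign `+1` and are subtracted from the target in
  -- advance.
  have hf0 := hf.sub (hint (Finset.range (S.start 0)) fun _ => 1)
  obtain ⟨v, hv1, hv2⟩ := exists_corrections_tendsto_zero u T z (fun n => by
      simp only [u, z]
      exact Integrable.toL1_zero _) (τ := fun n => 8 * (1 / 2) ^ n)
    (summable_geometric_two.mul_left 8) (fun n v => by
      simp only [T, u]
      rw [← Integrable.toL1_sub, L1.norm_of_fun_eq_integral_norm]
      exact hψ2 n v) (fun x ε hε => by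
      obtain ⟨B, K₀, hB⟩ := exists_dyadic_approx S.wmeas_ac (L1.integrable_coeFn x) hε
      obtain ⟨n₁, hn₁⟩ := exists_nat_ge B
      refine ⟨max K₀ n₁, fun n hn => ?_⟩
      obtain ⟨v, hvB, hv⟩ := hB (S.κ + n)
        (((le_max_left _ _).trans hn).trans (Nat.le_add_left _ _))
      refine ⟨⟨v, ?_⟩, ?_⟩
      · have h1 : (n₁ : ℝ) ≤ n := by exact_mod_cast (le_max_right _ _).trans hn
        refine (Finset.sum_le_sum fun b _ => (hvB b).trans (hn₁.trans h1)).trans ?_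
        simp [mul_comm]
      · simp only [u]
        rw [← Integrable.toL1_coeFn x (L1.integrable_coeFn x), ← Integrable.toL1_sub,
          L1.norm_of_fun_eq_integral_norm]
        exact hv) (hf0.toL1 _)
  set ε : ℕ → ℝ := fun k => if k < S.start 0 then 1 else
    ψ (levelIndex S.start k) (v (levelIndex S.start k)) k with hε
  have hεphase : ∀ n k, S.start n ≤ k → k < S.start (n + 1) → ε k = ψ n (v n) k := by
    intro n k h1 h2
    have h0 : S.start 0 ≤ k := (S.start_strictMono.monotone (Nat.zero_le n)).trans h1
    simp only [hε, if_neg (not_lt.2 h0)]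
    rw [levelIndex_eq S.start_strictMono h1 h2]
  have hr : ∀ n, hf0.toL1 _ - ∑ j ∈ Finset.range n, T j (v j) =
      (hf.sub (hint (Finset.range (S.start n)) ε)).toL1 _ := by
    intro n
    induction n with
    | zero =>
      rw [Finset.sum_range_zero, sub_zero]
      congr 1
      funext x
      simp only [Pi.sub_apply]
      congr 1
      refine Finset.sum_congr rfl fun k hk => ?_
      simp only [hε, if_pos (Finset.mem_range.1 hk)]
    | succ n ih =>
      rw [Finset.sum_range_succ, ← sub_sub, ih, ← Integrable.toL1_sub]
      congr 1
      funext x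
      simp only [Pi.sub_apply]
      rw [sub_sub]
      congr 1
      rw [← Finset.sum_range_add_sum_Ico _ (S.start_strictMono (Nat.lt_succ_self n)).le]
      congr 1
      refine Finset.sum_congr rfl fun k hk => ?_
      rw [hεphase n k (Finset.mem_Ico.1 hk).1 (Finset.mem_Ico.1 hk).2]
  simp only [hr] at hv1 hv2
  refine ⟨ε, fun k => ?_, ?_⟩
  · simp only [hε]
    split_ifs
    · exact Or.inl rfl
    · exact hψ1 _ _ _
  set a : ℕ → ℝ := fun n => ‖(hf.sub (hint (Finset.range (S.start n)) ε)).toL1 _‖ with ha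
  have ha0 : Tendsto a atTop (𝓝 0) := tendsto_zero_iff_norm_tendsto_zero.1 hv1
  have hidx : Tendsto (levelIndex S.start) atTop atTop :=
    Monotone.tendsto_atTop_atTop (fun _ _ h => levelIndex_mono _ h) fun n =>
      ⟨S.start n, (levelIndex_eq S.start_strictMono le_rfl
        (S.start_strictMono (Nat.lt_succ_self n))).ge⟩
  -- Inside phase `n` the error is at most the remainder `a n` at its start plus `‖v‖ + 19 * 2^-n`,
  -- and the correction satisfies `‖v‖ ≤ 2 * a n`.
  have hbound : Tendsto (fun n => 3 * a n + 19 * (1 / 2 : ℝ) ^ n) atTop (𝓝 0) := by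
    have := (ha0.const_mul 3).add ((tendsto_pow_atTop_nhds_zero_of_lt_one
      (by norm_num : (0 : ℝ) ≤ 1 / 2) (by norm_num)).const_mul 19)
    simpa using this
  refine squeeze_zero' (Eventually.of_forall fun m => integral_nonneg fun x => abs_nonneg _) ?_
    (hbound.comp hidx)
  filter_upwards [eventually_ge_atTop (S.start 0)] with m hm
  obtain ⟨h1, h2⟩ := levelIndex_spec S.start_strictMono hm
  simp only [Function.comp]
  set n := levelIndex S.start m
  have e1 := hψ3 n (v n) m h1 h2
  have hsub : ∀ x, ∑ k ∈ Finset.Ico (S.start n) m, ψ n (v n) k * S.coeff k * walsh k x =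
      ∑ k ∈ Finset.Ico (S.start n) m, ε k * S.coeff k * walsh k x := fun x =>
    Finset.sum_congr rfl fun k hk => by
      rw [hεphase n k (Finset.mem_Ico.1 hk).1 ((Finset.mem_Ico.1 hk).2.trans h2)]
  simp only [hsub] at e1
  have e2 : ∫ x, |(v n).1 (dyadicCell (S.κ + n) x)| ∂S.wmeas ≤ 2 * a n := by
    have := hv2 n
    simp only [u] at this
    rw [L1.norm_of_fun_eq_integral_norm] at this
    exact this
  have e3 : ∫ x, |∑ k ∈ Finset.range (S.start n), ε k * S.coeff k * walsh k x - f x| ∂S.wmeas =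
      a n := by
    simp only [ha]
    rw [L1.norm_of_fun_eq_integral_norm]
    refine integral_congr_ae (Eventually.of_forall fun x => ?_)
    simp only [Pi.sub_apply, Real.norm_eq_abs]
    exact abs_sub_comm _ _
  have e4 := integral_abs_add_le ((hint (Finset.range (S.start n)) ε).sub hf)
    (hint (Finset.Ico (S.start n) m) ε)
  have e5 : ∀ x, ∑ k ∈ Finset.range (S.start n), ε k * S.coeff k * walsh k x - f x +
      ∑ k ∈ Finset.Ico (S.start n) m, ε k * S.coeff k * walsh k x =
      ∑ k ∈ Finset.range m, ε k * S.coeff k * walsh k x - f x := fun x => by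
    rw [← Finset.sum_range_add_sum_Ico _ h1]
    ring
  simp only [Pi.sub_apply, e5] at e4
  linarith

end WalshScheme

/-! ### The function with the prescribed coefficients -/

namespace WalshScheme

variable (S : WalshScheme)

/-- A Walsh function as an element of `L¹`. -/
noncomputable def walshL1 (k : ℕ) : ℝ →₁[unitMeasure] ℝ := (integrable_walsh unitMeasure k).toL1 _

theorem sum_walshL1 (F : Finset ℕ) (a : ℕ → ℝ) :
    ∑ k ∈ F, a k • walshL1 k = (integrable_sum_walsh unitMeasure F a).toL1 _ := by
  classical
  induction F using Finset.induction_on with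
  | empty => simp only [Finset.sum_empty]; exact (Integrable.toL1_zero _).symm
  | insert k F hk ih =>
    simp only [Finset.sum_insert hk]
    rw [ih, walshL1, ← Integrable.toL1_smul, ← Integrable.toL1_add]
    rfl

theorem norm_walshL1_le (k : ℕ) : ‖walshL1 k‖ ≤ 1 := by
  rw [walshL1, L1.norm_of_fun_eq_integral_norm]
  refine (integral_mono (integrable_walsh _ k).norm (integrable_const 1)
    fun x => abs_walsh_le_one k x).trans (by simp)

theorem norm_sum_walshL1_two_pow_le (n : ℕ) : ‖∑ k ∈ Finset.range (2 ^ n), walshL1 k‖ ≤ 1 := by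
  have := sum_walshL1 (Finset.range (2 ^ n)) fun _ => 1
  simp only [one_smul] at this
  rw [this, L1.norm_of_fun_eq_integral_norm]
  refine le_of_eq ((integral_congr_ae (Eventually.of_forall fun x => ?_)).trans
    (integral_prod_one_add_radSeq 0 n))
  simp only [one_mul, walsh_eq, sum_range_wal, zero_add, Real.norm_eq_abs]
  exact abs_of_nonneg (prod_one_add_radSeq_nonneg x _ _)

/-- Abel summation by steps: only kernels of order `2^s` appear, whose norms are at most 1, with
weights `C j - C (j+1)` of finite sum. -/
theorem sum_range_two_pow_C_smul {E : Type*} [AddCommGroup E] [Module ℝ E] (w : ℕ → E) (i : ℕ) :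
    ∑ k ∈ Finset.range (2 ^ S.s i), S.C (S.step k) • w k =
      S.C i • ∑ k ∈ Finset.range (2 ^ S.s i), w k +
      ∑ j ∈ Finset.range i, (S.C j - S.C (j + 1)) • ∑ k ∈ Finset.range (2 ^ S.s (j + 1)), w k := by
  induction i with
  | zero =>
    rw [Finset.sum_range_zero, add_zero, Finset.smul_sum]
    refine Finset.sum_congr rfl fun k hk => ?_
    have h0 : S.step (2 ^ S.s 0) = 0 := levelIndex_eq S.two_pow_s_strictMono le_rfl
      (S.two_pow_s_strictMono Nat.zero_lt_one)
    have h1 : S.step k ≤ S.step (2 ^ S.s 0) := levelIndex_mono _ (Finset.mem_range.1 hk).le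
    rw [Nat.le_zero.1 (h1.trans h0.le)]
  | succ i ih =>
    have hle := S.two_pow_s_strictMono.monotone (Nat.le_succ i)
    have hb : ∑ k ∈ Finset.Ico (2 ^ S.s i) (2 ^ S.s (i + 1)), S.C (S.step k) • w k =
        S.C i • ∑ k ∈ Finset.Ico (2 ^ S.s i) (2 ^ S.s (i + 1)), w k := by
      rw [Finset.smul_sum]
      exact Finset.sum_congr rfl fun k hk => by rw [S.step_eq hk]
    rw [← Finset.sum_range_add_sum_Ico _ hle, ih, hb, Finset.sum_Ico_eq_sub _ hle,
      Finset.sum_range_succ]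
    module

/-- The Walsh series with the coefficients of the scheme converges in `L¹`. -/
theorem exists_tendsto_sum_walshL1 :
    ∃ G : ℝ →₁[unitMeasure] ℝ,
      Tendsto (fun m => ∑ k ∈ Finset.range m, S.coeff k • walshL1 k) atTop (𝓝 G) := by
  set d : ℕ → (ℝ →₁[unitMeasure] ℝ) := fun i => ∑ k ∈ Finset.range (2 ^ S.s i), walshL1 k with hd
  have hd1 : ∀ i, ‖d i‖ ≤ 1 := fun i => norm_sum_walshL1_two_pow_le _
  have hC : Summable fun j => S.C j - S.C (j + 1) := by
    refine summable_of_sum_range_le (c := S.C 0)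
      (fun j => sub_nonneg.2 (S.C_anti (Nat.le_succ j))) fun n => ?_
    rw [Finset.sum_range_sub']
    linarith [S.C_pos n]
  have h1 : Summable fun j => (S.C j - S.C (j + 1)) • d (j + 1) := by
    refine Summable.of_norm_bounded hC fun j => ?_
    have h0 := sub_nonneg.2 (S.C_anti (Nat.le_succ j))
    rw [norm_smul, Real.norm_of_nonneg h0]
    exact mul_le_of_le_one_right h0 (hd1 _)
  have h2 : Summable fun k => ((1 / 2 : ℝ) ^ k) • walshL1 k := by
    refine Summable.of_norm_bounded summable_geometric_two fun k => ?_
    rw [norm_smul, Real.norm_of_nonneg (by positivity)]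
    exact mul_le_of_le_one_right (by positivity) (norm_walshL1_le k)
  have h3 : Tendsto (fun i => S.C i • d i) atTop (𝓝 0) := by
    refine squeeze_zero_norm (fun i => ?_) S.tendsto_C
    rw [norm_smul, Real.norm_of_nonneg (S.C_pos i).le]
    exact mul_le_of_le_one_right (S.C_pos i).le (hd1 i)
  have hpow : Tendsto (fun i => 2 ^ S.s i) atTop atTop := S.two_pow_s_strictMono.tendsto_atTop
  have h4 := (h3.add h1.hasSum.tendsto_sum_nat).add (h2.hasSum.tendsto_sum_nat.comp hpow)
  set A : ℕ → (ℝ →₁[unitMeasure] ℝ) := fun m => ∑ k ∈ Finset.range m, S.coeff k • walshL1 k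
  have h5 : ∀ i, A (2 ^ S.s i) = S.C i • d i +
      ∑ j ∈ Finset.range i, (S.C j - S.C (j + 1)) • d (j + 1) +
      ∑ k ∈ Finset.range (2 ^ S.s i), ((1 / 2 : ℝ) ^ k) • walshL1 k := by
    intro i
    rw [← S.sum_range_two_pow_C_smul, ← Finset.sum_add_distrib]
    exact Finset.sum_congr rfl fun k _ => by rw [coeff, add_smul]
  have h6 : Tendsto (fun i => A (2 ^ S.s i)) atTop
      (𝓝 (0 + ∑' j, (S.C j - S.C (j + 1)) • d (j + 1) + ∑' k, ((1 / 2 : ℝ) ^ k) • walshL1 k)) :=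
    h4.congr fun i => (h5 i).symm
  -- Between the ends of a step, the kernel bound with all signs `+1` shows that the partial sums
  -- move by at most `13 * 2^-phase`.
  have h7 : Tendsto (fun m => A m - A (2 ^ S.s (S.step m))) atTop (𝓝 0) := by
    have hb := (((tendsto_pow_atTop_nhds_zero_of_lt_one (by norm_num : (0 : ℝ) ≤ 1 / 2)
      (by norm_num)).comp (S.tendsto_phase.comp S.tendsto_step)).const_mul 13)
    rw [mul_zero] at hb
    refine squeeze_zero_norm' ?_ hb
    filter_upwards [eventually_ge_atTop (2 ^ S.s 0)] with m hm
    obtain ⟨hm1, hm2⟩ := Finset.mem_Ico.1 (S.mem_block_step hm)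
    simp only [A]
    rw [← Finset.sum_Ico_eq_sub _ hm1, sum_walshL1, L1.norm_of_fun_eq_integral_norm]
    have e := S.integral_abs_partial_step_le (ψ := fun _ => 1) (fun _ => Or.inl rfl) hm2.le
      (integral_abs_sum_periodic_le (φ := fun _ => 1) (fun _ => by simp) (fun _ _ => rfl) hm1
        (by rw [← S.s_succ]; exact hm2.le))
    simp only [one_mul] at e
    exact e
  have h8 := h7.add (h6.comp S.tendsto_step)
  simp only [Function.comp, sub_add_cancel] at h8
  exact ⟨_, h8⟩

/-- A function whose Walsh series has the coefficients of the scheme and converges in mean. -/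
theorem exists_function :
    ∃ g : ℝ → ℝ, Integrable g unitMeasure ∧ walshCoeff g = S.coeff ∧
      Tendsto (fun m => ∫ x, |∑ k ∈ Finset.range m, S.coeff k * walsh k x - g x| ∂unitMeasure)
        atTop (𝓝 0) := by
  obtain ⟨G, hG⟩ := S.exists_tendsto_sum_walshL1
  have hGi : Integrable G unitMeasure := L1.integrable_coeFn G
  have hint := fun m => integrable_sum_walsh unitMeasure (Finset.range m) S.coeff
  have hlim : Tendsto (fun m => ∫ x, |∑ k ∈ Finset.range m, S.coeff k * walsh k x - G x|
      ∂unitMeasure) atTop (𝓝 0) := by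
    refine (tendsto_iff_norm_sub_tendsto_zero.1 hG).congr fun m => ?_
    rw [sum_walshL1, ← Integrable.toL1_coeFn G hGi, ← Integrable.toL1_sub,
      L1.norm_of_fun_eq_integral_norm, Integrable.toL1_coeFn]
    rfl
  refine ⟨G, hGi, ?_, hlim⟩
  funext k
  have hprod : ∀ {h : ℝ → ℝ}, Integrable h unitMeasure →
      Integrable (fun x => h x * walsh k x) unitMeasure := fun hh =>
    hh.mul_bdd (c := 1) (measurable_walsh k).aestronglyMeasurable
      (Eventually.of_forall fun x => abs_walsh_le_one k x)
  have hA : ∀ m, k < m → ∫ x, (∑ j ∈ Finset.range m, S.coeff j * walsh j x) * walsh k x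
      ∂unitMeasure = S.coeff k := by
    intro m hm
    simp only [Finset.sum_mul, mul_assoc]
    rw [integral_finsetSum _ fun j _ => (hprod (integrable_walsh _ j)).const_mul _]
    simp only [integral_const_mul, integral_walsh_mul_walsh]
    simp [hm]
  -- Coefficients are continuous in `L¹`, and those of the partial sums are known by orthogonality.
  have hle : ∀ᶠ m in atTop, |S.coeff k - walshCoeff G k| ≤
      ∫ x, |∑ k ∈ Finset.range m, S.coeff k * walsh k x - G x| ∂unitMeasure := by
    filter_upwards [eventually_gt_atTop k] with m hm
    rw [← hA m hm, walshCoeff, ← integral_sub (hprod (hint m)) (hprod hGi)]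
    refine abs_integral_le_integral_abs.trans ?_
    refine integral_mono ((hprod (hint m)).sub (hprod hGi)).abs ((hint m).sub hGi).abs fun x => ?_
    dsimp only
    rw [← sub_mul, abs_mul]
    exact mul_le_of_le_one_right (abs_nonneg _) (abs_walsh_le_one k x)
  have h0 := abs_nonpos_iff.1 (ge_of_tendsto hlim hle)
  linarith

end WalshScheme

/-! ### The theorem -/

theorem mainTheorem1 (δ : ℝ) (hδ : 0 < δ) :
    ∃ g μ : ℝ → ℝ,
      IntegrableOn g (Icc (0 : ℝ) 1) ∧ IsWeight μ ∧ IsUniversalForSigns μ g ∧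
      ENNReal.ofReal (1 - δ) < volume {x : ℝ | x ∈ Icc (0 : ℝ) 1 ∧ μ x = 1} ∧
      StrictAnti (walshCoeff g) ∧ Tendsto (walshCoeff g) atTop (𝓝 0) ∧
      Tendsto
        (fun m : ℕ => ∫ x in Icc (0 : ℝ) 1,
          |(∑ k ∈ Finset.range (m + 1), walshCoeff g k * walsh k x) - g x|)
        atTop (𝓝 0) := by
  -- Replacing `δ` by `min δ 1` keeps the complement of the exceptional sets of positive measure, as
  -- needed for the strict inequality after truncation by `ENNReal.ofReal`.
  obtain ⟨S, hS⟩ := exists_walshScheme (lt_min hδ zero_lt_one)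
  obtain ⟨g, hg, hcoeff, hlim⟩ := S.exists_function
  refine ⟨g, S.weight, hg, S.isWeight_weight, ⟨hg, fun f hf => ?_⟩, ?_, ?_, ?_, ?_⟩
  · have hfi : Integrable f S.wmeas := by
      rw [S.integrable_wmeas_iff]
      have hm : AEStronglyMeasurable (fun x => f x * S.weight x) unitMeasure :=
        (hf.1.mul S.measurable_weight.aemeasurable).aestronglyMeasurable
      refine (integrable_norm_iff hm).1 (hf.2.congr (Eventually.of_forall fun x => ?_))
      simp only [norm_mul, Real.norm_eq_abs, abs_of_pos (S.weight_pos x)]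
    obtain ⟨ε, hε1, hε2⟩ := S.exists_signs_tendsto hfi
    refine ⟨ε, hε1, ?_⟩
    rw [hcoeff]
    simp only [S.integral_wmeas] at hε2
    exact hε2.comp (tendsto_add_atTop_nat 1)
  · exact (ENNReal.ofReal_le_ofReal (by linarith [min_le_left δ 1])).trans_lt
      (S.lt_volume_weight_eq_one (min_le_right δ 1) hS)
  · rw [hcoeff]; exact S.coeff_strictAnti
  · rw [hcoeff]; exact S.tendsto_coeff
  · rw [hcoeff]; exact hlim.comp (tendsto_add_atTop_nat 1)
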